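/- Let $p\ge 1$, let $\mathbb D^p=\{z\in\mathbb C^p:|z_j|<1,\ 1\le j\le p\}$, and let $$f(z)=\sum_{n\in\mathbb Z_+^p}a_nz^n,\qquad z^n=z_1^{n_1}\cdots z_p^{n_p},$$ be a power series with complex coefficients, not all zero, that converges absolutely at every point of $\mathbb D^p$. For $r\in[0,1)^p$ put $\mu_f(r)=\max\{|a_n|r^n:n\in\mathbb Z_+^p\}$. Let $P$ be Lebesgue measure on $[0,1]$. A family of real Lebesgue measurable functions $(X_n(t))_{n\in\mathbb Z_+^p}$ on $[0,1]$ is called a real multiplicative system if, for every $k\ge1$ and all pairwise distinct indices $n^{(1)},\dots,n^{(k)}$, the product $X_{n^{(1)}}\cdots X_{n^{(k)}}$ is integrable and $\int_0^1X_{n^{(1)}}(t)\cdots X_{n^{(k)}}(t)\,dt=0$. Let $Z=(Z_n)_{n\in\mathbb Z_+^p}$, $Z_n=X_n+iY_n$, where $(X_n)$ and $(Y_n)$ are both real multiplicative systems, and suppose that for every $n$ one has $|Z_n(t)|\le1$ for almost all $t\in[0,1]$. Put $$f(z,t)=\sum_{n\in\mathbb Z_+^p}a_nZ_n(t)z^n,\qquad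 M_f(r,t)=\max\{|f(z,t)|:|z_j|\le r_j,\ 1\le j\le p\}.$$ A measurable set $E\subset[0,1)^p$ is said to have asymptotically finite logarithmic measure if there is $r^0\in[0,1)^p$ such that $$\int_{E\cap\{r\in[0,1)^p:\ r_j\ge r^0_j,\ 1\le j\le p\}}\ \prod_{j=1}^p\frac{dr_j}{1-r_j}<+\infty.$$ **Theorem.** Let $\delta>0$. For almost every $t\in[0,1]$ the series $f(\cdot,t)$ converges absolutely at every point of $\mathbb D^p$, and there is a set $E=E(f,t,\delta)\subset[0,1)^p$ of asymptotically finite logarithmic measure such that for all $r\in[0,1)^p\setminus E$ one has $\mu_f(r)\prod_{j=1}^p\frac1{1-r_j}>1$ and $$M_f(r,t)\le\mu_f(r)\left(\prod_{j=1}^p\frac1{\sqrt{1-r_j}}\cdot\ln^{p/4}\Bigl\{\mu_f(r)\prod_{j=1}^p\frac1{1-r_j}\Bigr\}\right)^{1+\delta}.$$ -/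

import Mathlib

open MeasureTheory

noncomputable section

namespace Polydisc

/-- The open unit polydisc `𝔻^p` in `ℂ^p`. -/
def unitPolydisc (p : ℕ) : Set (Fin p → ℂ) := {z | ∀ j, ‖z j‖ < 1}

/-- The half-open cube `[0,1)^p`. -/
def cube (p : ℕ) : Set (Fin p → ℝ) := {r | ∀ j, 0 ≤ r j ∧ r j < 1}

/-- The sum of the power series `∑ aₙ z₁^{n₁} ⋯ z_p^{n_p}` over all multi-indices. -/
def powerSum {p : ℕ} (a : (Fin p → ℕ) → ℂ) (z : Fin p → ℂ) : ℂ :=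
  ∑' n, a n * ∏ j, z j ^ n j

/-- The power series with coefficients `a` converges (unconditionally, which is the same as
absolutely) at every point of the unit polydisc, so that it represents a function that is analytic
there.  It may converge on a larger domain. -/
def ConvergesInPolydisc {p : ℕ} (a : (Fin p → ℕ) → ℂ) : Prop :=
  ∀ z ∈ unitPolydisc p, Summable fun n => a n * ∏ j, z j ^ n j

/-- The maximum modulus `M(r) = max {|f(z)| : |z_j| ≤ r_j}` of the power series. -/
def maxModulus {p : ℕ} (a : (Fin p → ℕ) → ℂ) (r : Fin p → ℝ) : ℝ :=
  sSup ((fun z => ‖powerSum a z‖) '' {z : Fin p → ℂ | ∀ j, ‖z j‖ ≤ r j})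

/-- The maximal term `μ(r) = max {|aₙ| r^n : n}` of the power series. -/
def maxTerm {p : ℕ} (a : (Fin p → ℕ) → ℂ) (r : Fin p → ℝ) : ℝ :=
  sSup (Set.range fun n : Fin p → ℕ => ‖a n‖ * ∏ j, r j ^ n j)

/-- The part `{s ∈ [0,1)^p : s_j ≥ r_j for all j}` of the cube. -/
def corner {p : ℕ} (r : Fin p → ℝ) : Set (Fin p → ℝ) := {s | s ∈ cube p ∧ ∀ j, r j ≤ s j}

/-- The logarithmic measure `∫_E ∏ dr_i / (1 - r_i)` of a set `E ⊆ [0,1)^p`. -/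
def logMeasure {p : ℕ} (E : Set (Fin p → ℝ)) : ENNReal :=
  ∫⁻ r in E, ∏ i, ENNReal.ofReal (1 / (1 - r i))

/-- `E` is a (measurable) subset of `[0,1)^p` of asymptotically finite logarithmic measure. -/
def AsympFiniteLogMeasure {p : ℕ} (E : Set (Fin p → ℝ)) : Prop :=
  E ⊆ cube p ∧ MeasurableSet E ∧ ∃ r₀ ∈ cube p, logMeasure (E ∩ corner r₀) < ⊤

/-- A real multiplicative system on the Steinhaus space `[0,1]` with Lebesgue measure: Lebesgue
measurable functions such that the product of any finitely many (at least one) of them with pairwise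
distinct indices has expected value zero. -/
structure IsMultiplicativeSystem {ι : Type*} (X : ι → unitInterval → ℝ) : Prop where
  aemeasurable : ∀ n, AEMeasurable (X n) volume
  integrable_prod : ∀ s : Finset ι, s.Nonempty → Integrable (fun t => ∏ n ∈ s, X n t) volume
  integral_prod : ∀ s : Finset ι, s.Nonempty → ∫ t, ∏ n ∈ s, X n t = 0

/-- A complex multiplicative system: `Zₙ = Xₙ + i Yₙ` where both `X` and `Y` are real
multiplicative systems. -/
def IsComplexMultiplicativeSystem {ι : Type*} (Z : ι → unitInterval → ℂ) : Prop :=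
  IsMultiplicativeSystem (fun n t => (Z n t).re) ∧ IsMultiplicativeSystem (fun n t => (Z n t).im)

/-- The coefficients `aₙ Zₙ(t)` of the random power series `f(·, t)`. -/
def randomCoeff {p : ℕ} (a : (Fin p → ℕ) → ℂ) (Z : (Fin p → ℕ) → unitInterval → ℂ)
    (t : unitInterval) : (Fin p → ℕ) → ℂ :=
  fun n => a n * Z n t

end Polydisc

end

noncomputable section

namespace Polydisc

open Set Filter Topology

/-! ### One-variable estimates: integrals of logarithmic derivatives of power series. -/

section OneVariable

/-! Write S(r) for the sum of |a_n| r^n, P(r) for the product of the 1/(1 - r_j), and μ for the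
maximal term. The numbers |a_n| r^n / S(r) form a probability distribution on multi-indices. The
mean A_i of the i-th index is r_i ∂_i ln S, and its variance V_i is r_i ∂_i A_i.

Deterministic half. Since G'/G^(1+ε) has integral at most 1/ε (`setLIntegral_deriv_div_rpow_le`),
applied along each coordinate to G = ln(S/c) + 1 and to A_i + 1, the estimate
`logMeasure_superlevel_lt_top` bounds A_i and V_i, outside a set of finite logarithmic measure, by
1/(1 - r_i) and (1/(1 - r_i))^2 up to powers of G and small powers of P. By Chebyshev
(`total_le_of_variance_le`) at least half of the mass lies in a box of side comparable to the
standard deviations, where every weight is at most μ. Hence S is at most a constant times μ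
P^(1+O(ε)) G^(p/2+O(ε)): this is the Wiman type bound `majorant_le_of_notMem`.

Random half. A bounded multiplicative system has Gaussian tails (`measureReal_le_norm_tsum_le`), and
at a point with |z_j| ≤ r_j the sum of squares of the coefficients is at most μ S. So |f(z,t)| is at
most of order D^ε √(μ S), with D = P G, except with probability decaying faster than any power of D.
A net of polynomially many points in D therefore costs nothing: the exceptional probability at r is
O(1/P) (`exists_volume_badSet_le`), exactly what Fubini against the density P needs
(`ae_logMeasure_section_lt_top`). Off the net, f varies by O(μ), controlled by the first moments
(`maxModulus_le_of_notMem_badSet`).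

The square root in √(μ S) halves both exponents of the Wiman bound, giving P^(1/2) and G^(p/4). The
same bound gives G = O(ln(μ P)), and P^(δ/2) absorbs constants and powers of P^ε
(`exists_final_bound`). -/

theorem natCast_mul_pow_pred_le {t s : ℝ} (ht : 0 ≤ t) (hts : t < s) (k : ℕ) :
    k * t ^ (k - 1) ≤ s ^ k / (s - t) := by
  rw [le_div_iff₀ (sub_pos.2 hts)]
  induction k with
  | zero => simp
  | succ k ih =>
    have h1 : (k : ℝ) * t ^ k = t * (k * t ^ (k - 1)) := by
      cases k with
      | zero => simp
      | succ k => simp only [Nat.add_sub_cancel, pow_succ]; ring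
    have h2 : t ^ k ≤ s ^ k := pow_le_pow_left₀ ht hts.le k
    calc ((k + 1 : ℕ) : ℝ) * t ^ (k + 1 - 1) * (s - t)
        = (k * t ^ k) * (s - t) + t ^ k * (s - t) := by
          push_cast; ring
      _ = t * (k * t ^ (k - 1) * (s - t)) + t ^ k * (s - t) := by rw [h1]; ring
      _ ≤ t * s ^ k + s ^ k * (s - t) :=
          add_le_add (mul_le_mul_of_nonneg_left ih ht)
            (mul_le_mul_of_nonneg_right h2 (sub_nonneg.2 hts.le))
      _ = s ^ (k + 1) := by ring

variable {ι : Type*} {b : ι → ℝ} {k : ι → ℕ}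

theorem summable_natCast_mul_pow (hb : ∀ n, 0 ≤ b n)
    (hs : ∀ t : ℝ, 0 ≤ t → t < 1 → Summable fun n => b n * t ^ k n) {t : ℝ} (ht0 : 0 ≤ t)
    (ht1 : t < 1) : Summable fun n => (k n * b n) * t ^ k n := by
  obtain ⟨s, hts, hs1⟩ := exists_between ht1
  refine Summable.of_nonneg_of_le (fun n => by have := hb n; positivity) (fun n => ?_)
    ((hs s (ht0.trans hts.le) hs1).mul_right (1 / (s - t)))
  have h1 : (k n : ℝ) * t ^ k n ≤ k n * t ^ (k n - 1) :=
    mul_le_mul_of_nonneg_left (pow_le_pow_of_le_one ht0 ht1.le (Nat.sub_le _ _)) (by positivity)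
  calc (k n * b n) * t ^ k n = b n * (k n * t ^ k n) := by ring
    _ ≤ b n * (s ^ k n / (s - t)) :=
        mul_le_mul_of_nonneg_left (h1.trans (natCast_mul_pow_pred_le ht0 hts _)) (hb n)
    _ = b n * s ^ k n * (1 / (s - t)) := by ring

/-- The derivative is written as a series in the same powers t^k divided by t, so that the lemma can
be applied again to the series with coefficients k b. Two radii t < s' < s < 1 are used: s' bounds
the interval of differentiation, and the gap s - s' absorbs the factor k. -/
theorem hasDerivAt_tsum_mul_pow (hb : ∀ n, 0 ≤ b n)
    (hs : ∀ t : ℝ, 0 ≤ t → t < 1 → Summable fun n => b n * t ^ k n) {t : ℝ} (ht0 : 0 < t)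
    (ht1 : t < 1) :
    HasDerivAt (fun x => ∑' n, b n * x ^ k n) ((∑' n, (k n * b n) * t ^ k n) / t) t := by
  obtain ⟨s', hts', hs'1⟩ := exists_between ht1
  obtain ⟨s, hs's, hs1⟩ := exists_between hs'1
  have key := hasDerivAt_tsum_of_isPreconnected (𝕜 := ℝ) (t := Ioo 0 s') (y := t) (y₀ := t)
    (g := fun n x => b n * x ^ k n) (g' := fun n x => b n * (k n * x ^ (k n - 1)))
    (u := fun n => b n * s ^ k n * (1 / (s - s')))
    ((hs s (by linarith) hs1).mul_right _) isOpen_Ioo isPreconnected_Ioo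
    (fun n y _ => (hasDerivAt_pow (k n) y).const_mul (b n)) (fun n y hy => ?_)
    ⟨ht0, hts'⟩ (hs t ht0.le ht1) ⟨ht0, hts'⟩
  · refine key.congr_deriv ?_
    rw [← tsum_div_const]
    refine tsum_congr fun n => ?_
    rcases h : k n with _ | m
    · simp
    · simp only [Nat.add_sub_cancel, pow_succ]
      field_simp
  · have h0 := hy.1.le
    rw [Real.norm_of_nonneg (by have := hb n; positivity)]
    calc b n * (k n * y ^ (k n - 1)) ≤ b n * (k n * s' ^ (k n - 1)) := by
          have := hb n
          have := hy.2.le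
          gcongr
      _ ≤ b n * (s ^ k n / (s - s')) :=
          mul_le_mul_of_nonneg_left (natCast_mul_pow_pred_le (by linarith) hs's _) (hb n)
      _ = _ := by ring

/-- The fundamental theorem of calculus on [x₀, u_n], followed by monotone convergence as u_n
increases to 1. The function need not extend to the endpoint 1, so a bound M replaces its value
there. -/
theorem setLIntegral_deriv_le {φ φ' : ℝ → ℝ} {x₀ m M : ℝ} (hx₀ : x₀ < 1)
    (hφ : ∀ x ∈ Ico x₀ 1, HasDerivAt φ (φ' x) x) (hφ' : ∀ x ∈ Ico x₀ 1, 0 ≤ φ' x)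
    (hm : m ≤ φ x₀) (hM : ∀ x ∈ Ico x₀ 1, φ x ≤ M) :
    ∫⁻ x in Ico x₀ 1, ENNReal.ofReal (φ' x) ≤ ENNReal.ofReal (M - m) := by
  obtain ⟨u, hu, hu1, hut⟩ := exists_seq_strictMono_tendsto' hx₀
  have hU : Ioo x₀ 1 ⊆ ⋃ n, Ioc x₀ (u n) := by
    intro x hx
    obtain ⟨n, hn⟩ := ((hut.eventually (lt_mem_nhds hx.2))).exists
    exact mem_iUnion.2 ⟨n, hx.1, hn.le⟩
  rw [← restrict_Ioo_eq_restrict_Ico]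
  refine (lintegral_mono_set hU).trans ?_
  rw [setLIntegral_iUnion_of_directed _ (monotone_nat_of_le_succ fun n =>
    Ioc_subset_Ioc_right (hu n.lt_succ_self).le).directed_le]
  refine iSup_le fun n => ?_
  have hsub : Icc x₀ (u n) ⊆ Ico x₀ 1 := fun x hx => ⟨hx.1, hx.2.trans_lt (hu1 n).2⟩
  have hle : x₀ ≤ u n := (hu1 n).1.le
  have hcont : ContinuousOn φ (Icc x₀ (u n)) := fun x hx =>
    (hφ x (hsub hx)).continuousAt.continuousWithinAt
  have hint : IntegrableOn φ' (Ioc x₀ (u n)) :=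
    intervalIntegral.integrableOn_deriv_of_nonneg hcont
      (fun x hx => hφ x (hsub (Ioo_subset_Icc_self hx)))
      (fun x hx => hφ' x (hsub (Ioo_subset_Icc_self hx)))
  rw [← ofReal_integral_eq_lintegral_ofReal hint
    ((ae_restrict_iff' measurableSet_Ioc).2 (ae_of_all _ fun x hx =>
      hφ' x (hsub (Ioc_subset_Icc_self hx))))]
  refine ENNReal.ofReal_le_ofReal ?_
  rw [← intervalIntegral.integral_of_le hle, intervalIntegral.integral_eq_sub_of_hasDerivAt
    (fun x hx => hφ x (hsub (by rwa [uIcc_of_le hle] at hx)))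
    ((intervalIntegrable_iff_integrableOn_Ioc_of_le hle).2 hint)]
  have := hM (u n) (hsub ⟨hle, le_rfl⟩)
  linarith

/-- If `1 ≤ G` is increasing and differentiable, then `G' / G ^ (1 + ε)` has a bounded integral. -/
theorem setLIntegral_deriv_div_rpow_le {G G' H : ℝ → ℝ} {x₀ ε : ℝ} (hx₀ : x₀ < 1) (hε : 0 < ε)
    (hG : ∀ x ∈ Ico x₀ 1, HasDerivAt G (G' x) x) (hG' : ∀ x ∈ Ico x₀ 1, 0 ≤ G' x)
    (hG1 : ∀ x ∈ Ico x₀ 1, 1 ≤ G x) (hH : ∀ x ∈ Ico x₀ 1, H x ≤ G' x) :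
    ∫⁻ x in Ico x₀ 1, ENNReal.ofReal (H x / G x ^ (1 + ε)) ≤ ENNReal.ofReal (1 / ε) := by
  -- The primitive of G'/G^(1+ε) is -G^(-ε)/ε, which takes values in [-1/ε, 0] because G ≥ 1.
  have h := setLIntegral_deriv_le (φ := fun x => -(1 / ε) * G x ^ (-ε))
    (φ' := fun x => G' x / G x ^ (1 + ε)) (m := -(1 / ε)) (M := 0) hx₀ ?_ ?_ ?_ ?_
  · rw [sub_neg_eq_add, zero_add] at h
    refine le_trans (setLIntegral_mono_ae' measurableSet_Ico (ae_of_all _ fun x hx => ?_)) h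
    have := hG1 x hx
    exact ENNReal.ofReal_le_ofReal (div_le_div_of_nonneg_right (hH x hx) (by positivity))
  · intro x hx
    have h1 : 0 < G x := by linarith [hG1 x hx]
    refine (((hG x hx).rpow_const (p := -ε) (Or.inl h1.ne')).const_mul (-(1 / ε))).congr_deriv ?_
    rw [show -ε - 1 = -(1 + ε) by ring, Real.rpow_neg h1.le]
    field_simp
  · intro x hx
    have := hG1 x hx
    have := hG' x hx
    positivity
  · have h1 := hG1 x₀ ⟨le_rfl, hx₀⟩
    have : G x₀ ^ (-ε) ≤ 1 := Real.rpow_le_one_of_one_le_of_nonpos h1 (by linarith)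
    have h2 : 0 < 1 / ε := by positivity
    nlinarith
  · intro x hx
    have := hG1 x hx
    have : 0 ≤ (1 / ε) * G x ^ (-ε) := by positivity
    linarith

/-- The mean of `k` under the weights `b n * t ^ k n`, integrated against a power of the logarithm
of the total weight. -/
theorem setLIntegral_mean_le (hb : ∀ n, 0 ≤ b n)
    (hs : ∀ t : ℝ, 0 ≤ t → t < 1 → Summable fun n => b n * t ^ k n) {x₀ ε c : ℝ}
    (hx₀ : 0 < x₀) (hx₁ : x₀ < 1) (hε : 0 < ε) (hc : 0 < c)
    (hS : ∀ t ∈ Ico x₀ 1, c ≤ ∑' n, b n * t ^ k n) :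
    ∫⁻ t in Ico x₀ 1, ENNReal.ofReal (((∑' n, (k n * b n) * t ^ k n) / ∑' n, b n * t ^ k n) /
      (Real.log ((∑' n, b n * t ^ k n) / c) + 1) ^ (1 + ε)) ≤ ENNReal.ofReal (1 / ε) := by
  have hS1 : ∀ t ∈ Ico x₀ 1, 0 ≤ (∑' n, (k n * b n) * t ^ k n) / ∑' n, b n * t ^ k n := by
    intro t ht
    refine div_nonneg (tsum_nonneg fun n => ?_) (hc.le.trans (hS t ht))
    have := hb n; have := hx₀.trans_le ht.1; positivity
  refine setLIntegral_deriv_div_rpow_le (G := fun t => Real.log ((∑' n, b n * t ^ k n) / c) + 1)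
    (G' := fun t => ((∑' n, (k n * b n) * t ^ k n) / ∑' n, b n * t ^ k n) / t) hx₁ hε ?_ ?_ ?_ ?_
  · intro t ht
    have ht0 := hx₀.trans_le ht.1
    have hpos := hc.trans_le (hS t ht)
    refine ((((hasDerivAt_tsum_mul_pow hb hs ht0 ht.2).div_const c).log
      (div_pos hpos hc).ne').add_const (1 : ℝ)).congr_deriv ?_
    field_simp
  · exact fun t ht => div_nonneg (hS1 t ht) (hx₀.le.trans ht.1)
  · intro t ht
    have := Real.log_nonneg ((one_le_div hc).2 (hS t ht))
    linarith
  -- The actual derivative carries an extra factor 1/t, which is at least 1 and may be dropped.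
  · exact fun t ht => le_div_self (hS1 t ht) (hx₀.trans_le ht.1) ht.2.le

/-- The variance identity for the weights `w`. -/
theorem tsum_sq_sub_mul {w : ι → ℝ} {x : ι → ℝ} (h0 : Summable w)
    (h1 : Summable fun n => x n * w n) (h2 : Summable fun n => x n * (x n * w n))
    (hw : ∑' n, w n ≠ 0) :
    HasSum (fun n => (x n - (∑' n, x n * w n) / ∑' n, w n) ^ 2 * w n)
      ((((∑' n, x n * (x n * w n)) / ∑' n, w n) - ((∑' n, x n * w n) / ∑' n, w n) ^ 2) *
        ∑' n, w n) := by
  set A := (∑' n, x n * w n) / ∑' n, w n with hA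
  have h := (h2.hasSum.sub (h1.hasSum.mul_left (2 * A))).add (h0.hasSum.mul_left (A ^ 2))
  have h3 : ∑' n, x n * w n = A * ∑' n, w n := by rw [hA]; field_simp
  rw [h3] at h
  have h4 : (∑' n, x n * (x n * w n)) / (∑' n, w n) * (∑' n, w n) = ∑' n, x n * (x n * w n) := by
    field_simp
  rw [sub_mul, h4]
  have h5 : ∀ s, s - 2 * A * (A * ∑' n, w n) + A ^ 2 * ∑' n, w n = s - A ^ 2 * ∑' n, w n :=
    fun s => by ring
  rw [h5] at h
  exact h.congr_fun fun n => by ring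

/-- The variance of `k` under the weights `b n * t ^ k n`, integrated against a power of the
mean. -/
theorem setLIntegral_variance_le (hb : ∀ n, 0 ≤ b n)
    (hs : ∀ t : ℝ, 0 ≤ t → t < 1 → Summable fun n => b n * t ^ k n) {x₀ ε : ℝ}
    (hx₀ : 0 < x₀) (hx₁ : x₀ < 1) (hε : 0 < ε)
    (hS : ∀ t ∈ Ico x₀ 1, 0 < ∑' n, b n * t ^ k n) :
    ∫⁻ t in Ico x₀ 1, ENNReal.ofReal
      (((∑' n, (k n * (k n * b n)) * t ^ k n) / (∑' n, b n * t ^ k n) -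
        ((∑' n, (k n * b n) * t ^ k n) / ∑' n, b n * t ^ k n) ^ 2) /
      ((∑' n, (k n * b n) * t ^ k n) / (∑' n, b n * t ^ k n) + 1) ^ (1 + ε)) ≤
      ENNReal.ofReal (1 / ε) := by
  have hb1 : ∀ n, 0 ≤ k n * b n := fun n => mul_nonneg (by positivity) (hb n)
  have hs1 : ∀ t : ℝ, 0 ≤ t → t < 1 → Summable fun n => (k n * b n) * t ^ k n :=
    fun t h0 h1 => summable_natCast_mul_pow hb hs h0 h1
  have hS1 : ∀ t ∈ Ico x₀ 1, 0 ≤ (∑' n, (k n * b n) * t ^ k n) / ∑' n, b n * t ^ k n := by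
    intro t ht
    refine div_nonneg (tsum_nonneg fun n => ?_) (hS t ht).le
    have := hb n; have := hx₀.trans_le ht.1; positivity
  have hV : ∀ t ∈ Ico x₀ 1, 0 ≤ (∑' n, (k n * (k n * b n)) * t ^ k n) / (∑' n, b n * t ^ k n) -
        ((∑' n, (k n * b n) * t ^ k n) / ∑' n, b n * t ^ k n) ^ 2 := by
    intro t ht
    have ht0 := hx₀.trans_le ht.1
    have h := tsum_sq_sub_mul (x := fun n => (k n : ℝ)) (hs t ht0.le ht.2)
      (by simpa only [mul_assoc] using hs1 t ht0.le ht.2)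
      (by simpa only [mul_assoc] using summable_natCast_mul_pow hb1 hs1 ht0.le ht.2) (hS t ht).ne'
    have h' := h.nonneg fun n => mul_nonneg (sq_nonneg _) (mul_nonneg (hb n) (by positivity))
    simp only [← mul_assoc] at h' ⊢
    exact nonneg_of_mul_nonneg_left h' (hS t ht)
  refine setLIntegral_deriv_div_rpow_le
    (G := fun t => (∑' n, (k n * b n) * t ^ k n) / (∑' n, b n * t ^ k n) + 1)
    (G' := fun t => ((∑' n, (k n * (k n * b n)) * t ^ k n) / (∑' n, b n * t ^ k n) -
        ((∑' n, (k n * b n) * t ^ k n) / ∑' n, b n * t ^ k n) ^ 2) / t) hx₁ hε ?_ ?_ ?_ ?_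
  · intro t ht
    have ht0 := hx₀.trans_le ht.1
    have hpos := hS t ht
    refine (((hasDerivAt_tsum_mul_pow hb1 hs1 ht0 ht.2).div
      (hasDerivAt_tsum_mul_pow hb hs ht0 ht.2) hpos.ne').add_const (1 : ℝ)).congr_deriv ?_
    field_simp
  · exact fun t ht => div_nonneg (hV t ht) (hx₀.le.trans ht.1)
  · exact fun t ht => by linarith [hS1 t ht]
  · exact fun t ht => le_div_self (hV t ht) (hx₀.trans_le ht.1) ht.2.le

end OneVariable

/-! ### The distribution of the multi-index and its one-variable slices. -/

variable {p : ℕ}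

/-- The term `|aₙ| rⁿ`. -/
def weight (a : (Fin p → ℕ) → ℂ) (r : Fin p → ℝ) (n : Fin p → ℕ) : ℝ := ‖a n‖ * ∏ j, r j ^ n j

/-- The sum `∑ |aₙ| rⁿ`. -/
def majorant (a : (Fin p → ℕ) → ℂ) (r : Fin p → ℝ) : ℝ := ∑' n, weight a r n

/-- The mean of the `i`-th index under the weights `|aₙ| rⁿ`. -/
def meanIndex (a : (Fin p → ℕ) → ℂ) (i : Fin p) (r : Fin p → ℝ) : ℝ :=
  (∑' n : Fin p → ℕ, n i * weight a r n) / majorant a r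

/-- The variance of the `i`-th index under the weights `|aₙ| rⁿ`. -/
def varIndex (a : (Fin p → ℕ) → ℂ) (i : Fin p) (r : Fin p → ℝ) : ℝ :=
  (∑' n : Fin p → ℕ, n i * (n i * weight a r n)) / majorant a r - meanIndex a i r ^ 2

/-- The product `∏ 1 / (1 - r_j)`. -/
def density (r : Fin p → ℝ) : ℝ := ∏ j, 1 / (1 - r j)

/-- The part of the cube where every coordinate is at least `1 / 2`. -/
def halfCorner (p : ℕ) : Set (Fin p → ℝ) := corner fun _ => 1 / 2

theorem mem_halfCorner {r : Fin p → ℝ} : r ∈ halfCorner p ↔ ∀ j, r j ∈ Ico (1 / 2 : ℝ) 1 :=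
  ⟨fun h j => ⟨h.2 j, (h.1 j).2⟩, fun h => ⟨fun j => ⟨by linarith [(h j).1], (h j).2⟩,
    fun j => (h j).1⟩⟩

theorem measurableSet_cube : MeasurableSet (cube p) := by
  simp only [cube, ofPred_forall, ofPred_and]
  exact MeasurableSet.iInter fun j =>
    (measurableSet_le measurable_const (measurable_pi_apply j)).inter
      (measurableSet_lt (measurable_pi_apply j) measurable_const)

theorem measurableSet_corner (r : Fin p → ℝ) : MeasurableSet (corner r) := by
  have : corner r = cube p ∩ ⋂ j, {s | r j ≤ s j} := by
    ext s; simp [corner]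
  rw [this]
  exact measurableSet_cube.inter (MeasurableSet.iInter fun j =>
    measurableSet_le measurable_const (measurable_pi_apply j))

@[fun_prop]
theorem measurable_weight (a : (Fin p → ℕ) → ℂ) (n : Fin p → ℕ) :
    Measurable fun r => weight a r n := by
  unfold weight; fun_prop

@[fun_prop]
theorem measurable_majorant (a : (Fin p → ℕ) → ℂ) : Measurable (majorant a) := by
  unfold majorant; fun_prop

@[fun_prop]
theorem measurable_meanIndex (a : (Fin p → ℕ) → ℂ) (i : Fin p) : Measurable (meanIndex a i) := by
  unfold meanIndex; fun_prop

@[fun_prop]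
theorem measurable_varIndex (a : (Fin p → ℕ) → ℂ) (i : Fin p) : Measurable (varIndex a i) := by
  unfold varIndex; fun_prop

@[fun_prop]
theorem measurable_density : Measurable (density (p := p)) := by
  unfold density; fun_prop

@[fun_prop]
theorem measurable_maxTerm (a : (Fin p → ℕ) → ℂ) : Measurable (maxTerm a) :=
  Measurable.iSup fun n => measurable_weight a n

theorem one_le_one_div_one_sub {r : Fin p → ℝ} (hr : r ∈ cube p) (j : Fin p) :
    1 ≤ 1 / (1 - r j) := by
  have := hr j
  rw [le_div_iff₀] <;> linarith

theorem one_le_density {r : Fin p → ℝ} (hr : r ∈ cube p) : 1 ≤ density r :=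
  (Finset.prod_const_one (s := Finset.univ)).ge.trans
    (Finset.prod_le_prod (fun _ _ => zero_le_one) fun j _ => one_le_one_div_one_sub hr j)

theorem one_div_one_sub_le_density {r : Fin p → ℝ} (hr : r ∈ cube p) (j : Fin p) :
    1 / (1 - r j) ≤ density r := by
  rw [density, ← Finset.mul_prod_erase _ _ (Finset.mem_univ j)]
  refine le_mul_of_one_le_right (zero_le_one.trans (one_le_one_div_one_sub hr j)) ?_
  exact (Finset.prod_const_one (s := Finset.univ.erase j)).ge.trans
    (Finset.prod_le_prod (fun _ _ => zero_le_one) fun j _ => one_le_one_div_one_sub hr j)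

theorem weight_nonneg (a : (Fin p → ℕ) → ℂ) {r : Fin p → ℝ} (hr : ∀ j, 0 ≤ r j) (n : Fin p → ℕ) :
    0 ≤ weight a r n :=
  mul_nonneg (norm_nonneg _) (Finset.prod_nonneg fun j _ => pow_nonneg (hr j) _)

theorem summable_weight {a : (Fin p → ℕ) → ℂ} (ha : ConvergesInPolydisc a) {r : Fin p → ℝ}
    (hr : r ∈ cube p) : Summable (weight a r) := by
  have h := (ha (fun j => (r j : ℂ)) fun j => by
    rw [Complex.norm_real, Real.norm_of_nonneg (hr j).1]; exact (hr j).2).norm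
  refine h.congr fun n => ?_
  simp only [weight, norm_mul, norm_prod, norm_pow, Complex.norm_real]
  congr 1
  exact Finset.prod_congr rfl fun j _ => by rw [Real.norm_of_nonneg (hr j).1]

/-- With all coordinates but the i-th frozen, the weights have the form b_n t^(n_i) of the
one-variable section. -/
theorem weight_update (a : (Fin p → ℕ) → ℂ) (r : Fin p → ℝ) (i : Fin p) (t : ℝ) (n : Fin p → ℕ) :
    weight a (Function.update r i t) n =
      (‖a n‖ * ∏ j ∈ Finset.univ.erase i, r j ^ n j) * t ^ n i := by
  rw [weight, ← Finset.mul_prod_erase _ _ (Finset.mem_univ i), Function.update_self,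
    Finset.prod_congr rfl fun j hj => by
      rw [Function.update_of_ne (Finset.ne_of_mem_erase hj)]]
  ring

theorem update_mem_cube {r : Fin p → ℝ} (hr : r ∈ cube p) (i : Fin p) {t : ℝ} (h0 : 0 ≤ t)
    (h1 : t < 1) : Function.update r i t ∈ cube p := by
  intro j
  rcases eq_or_ne j i with rfl | h
  · simpa using ⟨h0, h1⟩
  · simpa [h] using hr j

theorem update_mem_halfCorner {r : Fin p → ℝ} (hr : r ∈ halfCorner p) (i : Fin p) {t : ℝ}
    (ht : t ∈ Ico (1 / 2 : ℝ) 1) : Function.update r i t ∈ halfCorner p := by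
  refine mem_halfCorner.2 fun j => ?_
  rcases eq_or_ne j i with rfl | h
  · simpa using ht
  · simpa [h] using mem_halfCorner.1 hr j

section Slices

variable {a : (Fin p → ℕ) → ℂ} (ha : ConvergesInPolydisc a) {r : Fin p → ℝ} (i : Fin p)
include ha

theorem summable_slice (hr : r ∈ cube p) (t : ℝ) (h0 : 0 ≤ t) (h1 : t < 1) :
    Summable fun n : Fin p → ℕ => (‖a n‖ * ∏ j ∈ Finset.univ.erase i, r j ^ n j) * t ^ n i :=
  (summable_weight ha (update_mem_cube hr i h0 h1)).congr fun n => weight_update a r i t n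

theorem summable_index_mul_weight (hr : r ∈ cube p) :
    Summable fun n : Fin p → ℕ => n i * weight a r n := by
  have hnn : ∀ n : Fin p → ℕ, 0 ≤ ‖a n‖ * ∏ j ∈ Finset.univ.erase i, r j ^ n j := fun n =>
    mul_nonneg (norm_nonneg _) (Finset.prod_nonneg fun j _ => pow_nonneg (hr j).1 _)
  refine (summable_natCast_mul_pow hnn (summable_slice ha i hr) (hr i).1 (hr i).2).congr
    fun n => ?_
  rw [mul_assoc, ← weight_update, Function.update_eq_self]

theorem summable_index_sq_mul_weight (hr : r ∈ cube p) :
    Summable fun n : Fin p → ℕ => n i * (n i * weight a r n) := by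
  have hnn : ∀ n : Fin p → ℕ, 0 ≤ ‖a n‖ * ∏ j ∈ Finset.univ.erase i, r j ^ n j := fun n =>
    mul_nonneg (norm_nonneg _) (Finset.prod_nonneg fun j _ => pow_nonneg (hr j).1 _)
  refine (summable_natCast_mul_pow (b := fun n : Fin p → ℕ => n i * (‖a n‖ *
      ∏ j ∈ Finset.univ.erase i, r j ^ n j)) (fun n => mul_nonneg (by positivity) (hnn n))
    (fun t h0 h1 => summable_natCast_mul_pow hnn (summable_slice ha i hr) h0 h1)
    (hr i).1 (hr i).2).congr fun n => ?_
  rw [mul_assoc, mul_assoc, ← weight_update, Function.update_eq_self]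

theorem setLIntegral_meanIndex_le {c ε : ℝ} (hc : 0 < c) (hε : 0 < ε)
    (hS : ∀ r ∈ halfCorner p, c ≤ majorant a r) (hr : r ∈ halfCorner p) :
    ∫⁻ t in Ico (1 / 2 : ℝ) 1, ENNReal.ofReal (meanIndex a i (Function.update r i t) /
      (Real.log (majorant a (Function.update r i t) / c) + 1) ^ (1 + ε)) ≤
        ENNReal.ofReal (1 / ε) := by
  have h := setLIntegral_mean_le (k := fun n : Fin p → ℕ => n i) (ε := ε) (c := c) (x₀ := 1 / 2)
    (fun n => mul_nonneg (norm_nonneg (a n)) (Finset.prod_nonneg fun j _ => pow_nonneg (hr.1 j).1 _))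
    (summable_slice ha i hr.1) (by norm_num) (by norm_num) hε hc fun t ht => by
      simpa only [majorant, weight_update] using hS _ (update_mem_halfCorner hr i ht)
  simpa only [meanIndex, majorant, weight_update, mul_assoc] using h

theorem setLIntegral_varIndex_le {ε : ℝ} (hε : 0 < ε)
    (hS : ∀ r ∈ halfCorner p, 0 < majorant a r) (hr : r ∈ halfCorner p) :
    ∫⁻ t in Ico (1 / 2 : ℝ) 1, ENNReal.ofReal (varIndex a i (Function.update r i t) /
      (meanIndex a i (Function.update r i t) + 1) ^ (1 + ε)) ≤ ENNReal.ofReal (1 / ε) := by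
  have h := setLIntegral_variance_le (k := fun n : Fin p → ℕ => n i) (ε := ε) (x₀ := 1 / 2)
    (fun n => mul_nonneg (norm_nonneg (a n)) (Finset.prod_nonneg fun j _ => pow_nonneg (hr.1 j).1 _))
    (summable_slice ha i hr.1) (by norm_num) (by norm_num) hε fun t ht => by
      simpa only [majorant, weight_update] using hS _ (update_mem_halfCorner hr i ht)
  simpa only [varIndex, meanIndex, majorant, weight_update, mul_assoc] using h

end Slices

/-! ### Logarithmic measure of superlevel sets. -/

section LogMeasure

theorem logMeasure_mono {E F : Set (Fin p → ℝ)} (h : E ⊆ F) : logMeasure E ≤ logMeasure F :=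
  lintegral_mono_set h

theorem logMeasure_union_le (E F : Set (Fin p → ℝ)) :
    logMeasure (E ∪ F) ≤ logMeasure E + logMeasure F :=
  lintegral_union_le _ _ _

theorem logMeasure_iUnion_le {ι : Type*} [Fintype ι] (E : ι → Set (Fin p → ℝ)) :
    logMeasure (⋃ i, E i) ≤ ∑ i, logMeasure (E i) :=
  (lintegral_iUnion_le _ _).trans_eq (tsum_fintype _)

/-- The function `(1 - t) ^ (ε - 1)` on `[0, 1)`, extended by zero. -/
def powDensity (ε : ℝ) : ℝ → ℝ := (Ico (0 : ℝ) 1).indicator fun t => (1 - t) ^ (ε - 1)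

theorem powDensity_nonneg (ε t : ℝ) : 0 ≤ powDensity ε t :=
  indicator_nonneg (fun t ht => Real.rpow_nonneg (by linarith [ht.2]) _) t

theorem measurable_powDensity (ε : ℝ) : Measurable (powDensity ε) :=
  Measurable.indicator (by fun_prop) measurableSet_Ico

theorem lintegral_powDensity (ε : ℝ) : ∫⁻ t, ENNReal.ofReal (powDensity ε t) =
    ∫⁻ t in Ico (0 : ℝ) 1, ENNReal.ofReal ((1 - t) ^ (ε - 1)) := by
  rw [← lintegral_indicator measurableSet_Ico]
  refine lintegral_congr fun t => ?_
  by_cases h : t ∈ Ico (0 : ℝ) 1 <;> simp only [powDensity, indicator, h, if_true, if_false,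
    ENNReal.ofReal_zero]

theorem integrable_powDensity {ε : ℝ} (hε : 0 < ε) : Integrable (powDensity ε) := by
  refine ⟨(measurable_powDensity ε).aestronglyMeasurable, ?_⟩
  rw [hasFiniteIntegral_iff_ofReal (ae_of_all _ (powDensity_nonneg ε)), lintegral_powDensity]
  refine (setLIntegral_deriv_le (φ := fun t => -(1 / ε) * (1 - t) ^ ε) (m := -(1 / ε)) (M := 0)
    zero_lt_one (fun t ht => ?_) (fun t ht => ?_) (by simp) fun t ht => ?_).trans_lt
    ENNReal.ofReal_lt_top
  · have h : 1 - t ≠ 0 := by linarith [ht.2]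
    refine ((((hasDerivAt_id t).const_sub 1).rpow_const (p := ε) (Or.inl h)).const_mul
      (-(1 / ε))).congr_deriv ?_
    simp only [id]
    field_simp
  · exact Real.rpow_nonneg (by linarith [ht.2]) _
  · have := Real.rpow_nonneg (show 0 ≤ 1 - t by linarith [ht.2]) ε
    have : 0 ≤ (1 / ε) * (1 - t) ^ ε := by positivity
    linarith

/-- Used to insert a harmless factor in the i-th variable when marginals are compared. -/
theorem one_le_lintegral_powDensity {ε : ℝ} (hε : ε ≤ 1) :
    1 ≤ ∫⁻ t, ENNReal.ofReal (powDensity ε t) := by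
  rw [lintegral_powDensity]
  calc (1 : ENNReal) = ∫⁻ t in Ico (0 : ℝ) 1, 1 := by simp
    _ ≤ _ := setLIntegral_mono_ae' measurableSet_Ico (ae_of_all _ fun t ht => by
      rw [ENNReal.one_le_ofReal]
      exact Real.one_le_rpow_of_pos_of_le_one_of_nonpos (by linarith [ht.2]) (by linarith [ht.1])
        (by linarith))

/-- An exceptional set estimate: one-dimensional integrability along the `i`-th coordinate bounds
the logarithmic measure of a superlevel set. -/
theorem logMeasure_superlevel_lt_top {ε : ℝ} (hε : 0 < ε) (hε1 : ε ≤ 1) (i : Fin p)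
    {N : (Fin p → ℝ) → ℝ} (hN : Measurable N)
    (h : ∀ r ∈ halfCorner p, ∫⁻ t in Ico (1 / 2 : ℝ) 1, ENNReal.ofReal (N (Function.update r i t)) ≤
      ENNReal.ofReal (1 / ε)) :
    logMeasure {r ∈ halfCorner p | 1 / (1 - r i) * density r ^ ε < N r} < ⊤ := by
  -- Q is an integrable weight in the variables other than the i-th. That variable is paid for by
  -- the hypothesis `h`.
  set Q : (Fin p → ℝ) → ℝ := fun r => ∏ j ∈ Finset.univ.erase i, powDensity ε (r j) with hQ
  have hQ0 : ∀ r, 0 ≤ Q r := fun r => Finset.prod_nonneg fun j _ => powDensity_nonneg _ _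
  have hQm : Measurable Q := Finset.measurable_prod _ fun j _ =>
    (measurable_powDensity ε).comp (measurable_pi_apply j)
  have hQu : ∀ r t, Q (Function.update r i t) = Q r := fun r t =>
    Finset.prod_congr rfl fun j hj => by rw [Function.update_of_ne (Finset.ne_of_mem_erase hj)]
  set F : (Fin p → ℝ) → ENNReal :=
    (halfCorner p).indicator fun r => ENNReal.ofReal (N r) * ENNReal.ofReal (Q r) with hF
  set K : (Fin p → ℝ) → ENNReal := fun r =>
    ENNReal.ofReal (1 / ε) * ENNReal.ofReal (∏ j, powDensity ε (r j)) with hK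
  have hFm : Measurable F :=
    (hN.ennreal_ofReal.mul hQm.ennreal_ofReal).indicator (measurableSet_corner _)
  have hKm : Measurable K := by
    have : Measurable fun r : Fin p → ℝ => ∏ j, powDensity ε (r j) :=
      Finset.measurable_prod _ fun j _ => (measurable_powDensity ε).comp (measurable_pi_apply j)
    fun_prop
  have hEm : MeasurableSet {r ∈ halfCorner p | 1 / (1 - r i) * density r ^ ε < N r} :=
    (measurableSet_corner _).inter (measurableSet_lt (by fun_prop) hN)
  have step1 : logMeasure {r ∈ halfCorner p | 1 / (1 - r i) * density r ^ ε < N r} ≤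
      ∫⁻ r, F r := by
    unfold logMeasure
    rw [← lintegral_indicator hEm]
    refine lintegral_mono fun r => ?_
    by_cases hr : r ∈ {r ∈ halfCorner p | 1 / (1 - r i) * density r ^ ε < N r}
    swap
    · rw [indicator_of_notMem hr]; exact zero_le
    have hrc := hr.1.1
    rw [indicator_of_mem hr, hF, indicator_of_mem hr.1,
      ← ENNReal.ofReal_prod_of_nonneg fun j _ => zero_le_one.trans (one_le_one_div_one_sub hrc j),
      ← ENNReal.ofReal_mul' (hQ0 r)]
    refine ENNReal.ofReal_le_ofReal ?_
    have hpos : ∀ j, 0 < 1 - r j := fun j => by linarith [(hrc j).2]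
    -- The density splits as its ε-th power times the product of (1 - r_j)^(ε-1). In the i-th factor
    -- the exponent is then worsened to -1, so on the superlevel set the density is at most N Q.
    have hP : density r ^ ε * Q r * (1 - r i) ^ (ε - 1) = density r := by
      have h1 : Q r * (1 - r i) ^ (ε - 1) = ∏ j, (1 - r j) ^ (ε - 1) := by
        rw [← Finset.prod_erase_mul _ _ (Finset.mem_univ i)]
        congr 1
        exact Finset.prod_congr rfl fun j _ =>
          indicator_of_mem (show r j ∈ Ico (0 : ℝ) 1 from hrc j) _
      rw [mul_assoc, h1, density, ← Real.finsetProd_rpow _ _ fun j _ =>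
        (div_nonneg zero_le_one (hpos j).le), ← Finset.prod_mul_distrib]
      refine Finset.prod_congr rfl fun j _ => ?_
      rw [one_div, Real.inv_rpow (hpos j).le, Real.rpow_sub (hpos j), Real.rpow_one]
      have := Real.rpow_pos_of_pos (hpos j) ε
      field_simp
    have h2 : (1 - r i) ^ (ε - 1) ≤ 1 / (1 - r i) := by
      rw [one_div, ← Real.rpow_neg_one]
      exact Real.rpow_le_rpow_of_exponent_ge (hpos i) (by linarith [(hrc i).1]) (by linarith)
    have h3 : 0 ≤ density r ^ ε * Q r :=
      mul_nonneg (Real.rpow_nonneg (zero_le_one.trans (one_le_density hrc)) _) (hQ0 r)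
    calc ∏ j, 1 / (1 - r j) = density r ^ ε * Q r * (1 - r i) ^ (ε - 1) := hP.symm
      _ ≤ density r ^ ε * Q r * (1 / (1 - r i)) := mul_le_mul_of_nonneg_left h2 h3
      _ = (1 / (1 - r i) * density r ^ ε) * Q r := by ring
      _ ≤ N r * Q r := mul_le_mul_of_nonneg_right hr.2.le (hQ0 r)
  have step2 : ∫⁻ r, F r ≤ ∫⁻ r, K r := by
    -- It suffices to integrate in the i-th variable alone: there the left side is at most Q/ε, and
    -- the right side is at least that.
    refine lintegral_le_of_lmarginal_le (μ := fun _ : Fin p => (volume : Measure ℝ)) {i} hFm hKm ?_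
    rw [lmarginal_singleton, lmarginal_singleton]
    intro r
    have hKr : ENNReal.ofReal (1 / ε) * ENNReal.ofReal (Q r) ≤
        ∫⁻ t, K (Function.update r i t) := by
      have : ∀ t, K (Function.update r i t) = ENNReal.ofReal (1 / ε) * ENNReal.ofReal (Q r) *
          ENNReal.ofReal (powDensity ε t) := by
        intro t
        simp only [hK]
        rw [← Finset.prod_erase_mul _ _ (Finset.mem_univ i), Function.update_self]
        have := hQu r t
        simp only [hQ] at this
        rw [this, ENNReal.ofReal_mul (hQ0 r), mul_assoc]
      simp_rw [this]
      rw [lintegral_const_mul _ (measurable_powDensity ε).ennreal_ofReal]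
      exact le_mul_of_one_le_right zero_le (one_le_lintegral_powDensity hε1)
    refine le_trans ?_ hKr
    by_cases hr : Function.update r i (1 / 2) ∈ halfCorner p
    · have hle : ∀ t, F (Function.update r i t) ≤ (Ico (1 / 2 : ℝ) 1).indicator
          (fun t => ENNReal.ofReal (N (Function.update r i t)) * ENNReal.ofReal (Q r)) t := by
        intro t
        by_cases ht : Function.update r i t ∈ halfCorner p
        · have hti : t ∈ Ico (1 / 2 : ℝ) 1 := by simpa using mem_halfCorner.1 ht i
          rw [hF, indicator_of_mem ht, indicator_of_mem hti, hQu]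
        · rw [hF, indicator_of_notMem ht]; exact zero_le
      refine (lintegral_mono hle).trans ?_
      rw [lintegral_indicator measurableSet_Ico, lintegral_mul_const' _ _ ENNReal.ofReal_ne_top]
      have := h _ hr
      simp only [Function.update_idem] at this
      gcongr
    · have hz : ∀ t, F (Function.update r i t) = 0 := by
        intro t
        refine indicator_of_notMem (fun ht => hr ?_) _
        have := update_mem_halfCorner ht i (t := 1 / 2) ⟨le_rfl, by norm_num⟩
        rwa [Function.update_idem] at this
      simp [hz]
  refine (step1.trans step2).trans_lt ?_
  rw [hK, lintegral_const_mul' _ _ ENNReal.ofReal_ne_top]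
  refine ENNReal.mul_lt_top ENNReal.ofReal_lt_top ?_
  exact (Integrable.fintype_prod (μ := fun _ : Fin p => (volume : Measure ℝ))
    fun _ => integrable_powDensity hε).lintegral_lt_top

end LogMeasure

/-! ### Chebyshev's inequality and the Wiman type bound for the majorant. -/

theorem card_Icc_ceil_floor_le {A T : ℝ} (hA : 0 ≤ A) (hT : 1 ≤ T) :
    ((Finset.Icc ⌈A - T⌉₊ ⌊A + T⌋₊).card : ℝ) ≤ 3 * T := by
  rw [Nat.card_Icc]
  rcases le_total ⌈A - T⌉₊ (⌊A + T⌋₊ + 1) with h | h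
  · rw [Nat.cast_sub h]
    have h1 := Nat.floor_le (show 0 ≤ A + T by linarith)
    have h2 := Nat.le_ceil (A - T)
    push_cast
    linarith
  · rw [Nat.sub_eq_zero_of_le h]
    simp only [Nat.cast_zero]
    linarith

/-- Chebyshev's inequality: the total weight is at most twice the maximal weight times the number
of lattice points in a box determined by the variances. -/
theorem total_le_of_variance_le (hp : 1 ≤ p) {w : (Fin p → ℕ) → ℝ} {S μ : ℝ} {A V β : Fin p → ℝ}
    (hw : HasSum w S) (hw0 : ∀ n, 0 ≤ w n) (hμ : ∀ n, w n ≤ μ) (hA : ∀ i, 0 ≤ A i)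
    (hV : ∀ i, HasSum (fun n : Fin p → ℕ => ((n i : ℝ) - A i) ^ 2 * w n) (V i * S))
    (hβ : ∀ i, V i ≤ β i) (hβ1 : ∀ i, 1 ≤ β i) :
    S ≤ 2 * μ * ∏ i, (3 * √(2 * p * β i)) := by
  have hp' : (1 : ℝ) ≤ p := by exact_mod_cast hp
  have hS0 : 0 ≤ S := hw.nonneg hw0
  have hμ0 : 0 ≤ μ := (hw0 0).trans (hμ 0)
  have hpos : ∀ i, 1 ≤ 2 * p * β i := fun i => by nlinarith [hβ1 i]
  set T : Fin p → ℝ := fun i => √(2 * p * β i) with hT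
  have hT1 : ∀ i, 1 ≤ T i := fun i => by
    rw [hT, Real.le_sqrt' one_pos]; simpa using hpos i
  have hT2 : ∀ i, T i ^ 2 = 2 * p * β i := fun i => Real.sq_sqrt (by linarith [hpos i])
  set W : Finset (Fin p → ℕ) :=
    Fintype.piFinset fun i => Finset.Icc ⌈A i - T i⌉₊ ⌊A i + T i⌋₊ with hW
  have hcard : (W.card : ℝ) ≤ ∏ i, (3 * T i) := by
    rw [hW, Fintype.card_piFinset]
    push_cast
    exact Finset.prod_le_prod (fun _ _ => by positivity) fun i _ =>
      card_Icc_ceil_floor_le (hA i) (hT1 i)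
  have hWs : HasSum (fun n => if n ∈ W then μ else 0) (W.card * μ) := by
    have h : HasSum (fun n => if n ∈ W then μ else 0) (∑ n ∈ W, if n ∈ W then μ else 0) :=
      hasSum_sum_of_ne_finset_zero fun n hn => if_neg hn
    rwa [Finset.sum_congr rfl fun n hn => if_pos hn, Finset.sum_const, nsmul_eq_mul] at h
  have hVs : HasSum (fun n : Fin p → ℕ => ∑ i, ((n i : ℝ) - A i) ^ 2 * w n / (2 * p * β i))
      (∑ i, V i * S / (2 * p * β i)) := hasSum_sum fun i _ => (hV i).div_const (2 * p * β i)
  -- Pointwise, w is at most μ on the box and is dominated off it by a Chebyshev term for some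
  -- coordinate. The factor 2p in T makes the p variance terms add up to at most S/2, which moves to
  -- the left.
  have hle := hasSum_le (fun n => ?_) hw (hWs.add hVs)
  · have h1 : ∑ i, V i * S / (2 * p * β i) ≤ S / 2 := by
      calc ∑ i, V i * S / (2 * p * β i) ≤ ∑ i : Fin p, S / (2 * p) :=
            Finset.sum_le_sum fun i _ => by
              rw [div_le_div_iff₀ (by linarith [hpos i]) (by linarith)]
              have := mul_le_mul_of_nonneg_right (hβ i) (show 0 ≤ S * (2 * p) by positivity)
              linarith
        _ = S / 2 := by
          rw [Finset.sum_const, Finset.card_univ, Fintype.card_fin, nsmul_eq_mul]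
          field_simp
    have h2 := mul_le_mul_of_nonneg_right hcard hμ0
    linarith
  · by_cases hn : n ∈ W
    · rw [if_pos hn]
      refine (hμ n).trans (le_add_of_nonneg_right (Finset.sum_nonneg fun i _ => ?_))
      have := hw0 n
      have := hβ1 i
      positivity
    · rw [if_neg hn, zero_add]
      obtain ⟨i, hi⟩ : ∃ i, T i < |(n i : ℝ) - A i| := by
        by_contra! hcon
        refine hn (Fintype.mem_piFinset.2 fun i => Finset.mem_Icc.2 ⟨?_, ?_⟩)
        · have := (abs_le.1 (hcon i)).1
          exact Nat.ceil_le.2 (by linarith)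
        · have := (abs_le.1 (hcon i)).2
          exact Nat.le_floor (by linarith)
      have h3 : 2 * p * β i ≤ ((n i : ℝ) - A i) ^ 2 := by
        rw [← hT2, ← sq_abs ((n i : ℝ) - A i)]
        exact pow_le_pow_left₀ (zero_le_one.trans (hT1 i)) hi.le 2
      calc w n ≤ ((n i : ℝ) - A i) ^ 2 * w n / (2 * p * β i) := by
            rw [le_div_iff₀ (by linarith [hpos i]), mul_comm]
            exact mul_le_mul_of_nonneg_right h3 (hw0 n)
        _ ≤ _ := Finset.single_le_sum
            (f := fun i => ((n i : ℝ) - A i) ^ 2 * w n / (2 * p * β i))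
            (fun i _ => by have := hw0 n; have := hβ1 i; positivity) (Finset.mem_univ i)

/-- `ln (𝔐(r) / c) + 1`, where `𝔐` is the majorant. -/
def logMajorant (a : (Fin p → ℕ) → ℂ) (c : ℝ) (r : Fin p → ℝ) : ℝ :=
  Real.log (majorant a r / c) + 1

@[fun_prop]
theorem measurable_logMajorant (a : (Fin p → ℕ) → ℂ) (c : ℝ) : Measurable (logMajorant a c) := by
  unfold logMajorant; fun_prop

/-- The exceptional set outside of which mean and variance of the indices are controlled. -/
def irregularSet (a : (Fin p → ℕ) → ℂ) (c ε : ℝ) : Set (Fin p → ℝ) :=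
  ⋃ i, ({r ∈ halfCorner p | 1 / (1 - r i) * density r ^ ε <
      meanIndex a i r / logMajorant a c r ^ (1 + ε)} ∪
    {r ∈ halfCorner p | 1 / (1 - r i) * density r ^ ε <
      varIndex a i r / (meanIndex a i r + 1) ^ (1 + ε)})

theorem measurableSet_halfCorner_lt {f g : (Fin p → ℝ) → ℝ} (hf : Measurable f)
    (hg : Measurable g) : MeasurableSet {r ∈ halfCorner p | f r < g r} :=
  (measurableSet_corner _).inter (measurableSet_lt hf hg)

theorem measurableSet_irregularSet (a : (Fin p → ℕ) → ℂ) (c ε : ℝ) :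
    MeasurableSet (irregularSet a c ε) :=
  MeasurableSet.iUnion fun i =>
    (measurableSet_halfCorner_lt (by fun_prop) (by fun_prop)).union
      (measurableSet_halfCorner_lt (by fun_prop) (by fun_prop))

theorem irregularSet_subset_cube (a : (Fin p → ℕ) → ℂ) (c ε : ℝ) :
    irregularSet a c ε ⊆ cube p :=
  iUnion_subset fun _ => union_subset (fun _ hr => hr.1.1) fun _ hr => hr.1.1

theorem logMeasure_irregularSet_lt_top {a : (Fin p → ℕ) → ℂ} (ha : ConvergesInPolydisc a)
    {c ε : ℝ} (hc : 0 < c) (hε : 0 < ε) (hε1 : ε ≤ 1)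
    (hS : ∀ r ∈ halfCorner p, c ≤ majorant a r) : logMeasure (irregularSet a c ε) < ⊤ := by
  refine (logMeasure_iUnion_le _).trans_lt (ENNReal.sum_lt_top.2 fun i _ =>
    (logMeasure_union_le _ _).trans_lt (ENNReal.add_lt_top.2 ⟨?_, ?_⟩))
  · exact logMeasure_superlevel_lt_top hε hε1 i (by fun_prop) fun r hr =>
      setLIntegral_meanIndex_le ha i hc hε hS hr
  · exact logMeasure_superlevel_lt_top hε hε1 i (by fun_prop) fun r hr =>
      setLIntegral_varIndex_le ha i hε (fun r hr => hc.trans_le (hS r hr)) hr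

theorem weight_le_maxTerm {a : (Fin p → ℕ) → ℂ} (ha : ConvergesInPolydisc a) {r : Fin p → ℝ}
    (hr : r ∈ cube p) (n : Fin p → ℕ) : weight a r n ≤ maxTerm a r := by
  refine le_csSup ?_ (mem_range_self n)
  refine ⟨majorant a r, ?_⟩
  rintro _ ⟨m, rfl⟩
  exact (summable_weight ha hr).le_tsum m fun k _ => weight_nonneg a (fun j => (hr j).1) k

theorem meanIndex_nonneg (a : (Fin p → ℕ) → ℂ) {r : Fin p → ℝ} (hr : ∀ j, 0 ≤ r j) (i : Fin p) :
    0 ≤ meanIndex a i r :=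
  div_nonneg (tsum_nonneg fun n => mul_nonneg (by positivity) (weight_nonneg a hr n))
    (tsum_nonneg fun n => weight_nonneg a hr n)

section Regular

variable {a : (Fin p → ℕ) → ℂ} (ha : ConvergesInPolydisc a) {c ε : ℝ} (hc : 0 < c)
  (hε : 0 < ε) (hε1 : ε ≤ 1) {r : Fin p → ℝ} (hr : r ∈ halfCorner p) (hS : c ≤ majorant a r)
  (hirr : r ∉ irregularSet a c ε)

include hc hS in
theorem one_le_logMajorant : 1 ≤ logMajorant a c r := by
  have := Real.log_nonneg ((one_le_div hc).2 hS)
  unfold logMajorant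
  linarith

include hc hr hS hirr

theorem meanIndex_le_of_notMem (i : Fin p) :
    meanIndex a i r ≤ 1 / (1 - r i) * density r ^ ε * logMajorant a c r ^ (1 + ε) := by
  have hG := one_le_logMajorant hc hS
  by_contra! h
  refine hirr (mem_iUnion.2 ⟨i, Or.inl ⟨hr, ?_⟩⟩)
  rwa [lt_div_iff₀ (by positivity)]

include hε hε1

/-- The mean bound is fed into the variance bound. The assumption ε ≤ 1 rounds exponents up: 2^(1+ε)
≤ 4, (1+ε)^2 ≤ 1 + 3ε, and the surplus q^ε is absorbed by P^ε. -/
theorem varIndex_le_of_notMem (i : Fin p) :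
    varIndex a i r ≤ 4 * (1 / (1 - r i)) ^ 2 * density r ^ (4 * ε) *
      logMajorant a c r ^ (1 + 3 * ε) := by
  have hG := one_le_logMajorant hc hS
  have hP := one_le_density hr.1
  have hq := one_le_one_div_one_sub hr.1 i
  have hqP := one_div_one_sub_le_density hr.1 i
  have hA := meanIndex_le_of_notMem hc hr hS hirr i
  have hA0 := meanIndex_nonneg a (fun j => (hr.1 j).1) i
  set G := logMajorant a c r
  set P := density r
  set q := 1 / (1 - r i)
  set A := meanIndex a i r
  have hP0 : 0 < P := by linarith
  have hG0 : 0 < G := by linarith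
  have hq0 : 0 < q := by linarith
  have h1 : varIndex a i r ≤ q * P ^ ε * (A + 1) ^ (1 + ε) := by
    by_contra! h
    refine hirr (mem_iUnion.2 ⟨i, Or.inr ⟨hr, ?_⟩⟩)
    rwa [lt_div_iff₀ (by positivity)]
  have h2 : A + 1 ≤ 2 * (q * P ^ ε * G ^ (1 + ε)) := by
    have : 1 ≤ q * P ^ ε * G ^ (1 + ε) :=
      one_le_mul_of_one_le_of_one_le (one_le_mul_of_one_le_of_one_le hq
        (Real.one_le_rpow hP hε.le)) (Real.one_le_rpow hG (by linarith))
    linarith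
  have h3 : (A + 1) ^ (1 + ε) ≤ 4 * (q * P ^ ε) * P ^ (2 * ε) * G ^ (1 + 3 * ε) := by
    calc (A + 1) ^ (1 + ε) ≤ (2 * (q * P ^ ε * G ^ (1 + ε))) ^ (1 + ε) :=
          Real.rpow_le_rpow (by linarith) h2 (by linarith)
      _ = (2 : ℝ) ^ (1 + ε) * (q ^ (1 + ε) * P ^ (ε * (1 + ε)) * G ^ ((1 + ε) * (1 + ε))) := by
          rw [Real.mul_rpow (by norm_num) (by positivity),
            Real.mul_rpow (by positivity) (by positivity),
            Real.mul_rpow (by positivity) (by positivity), ← Real.rpow_mul hP0.le,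
            ← Real.rpow_mul hG0.le]
      _ ≤ 4 * ((q * P ^ ε) * P ^ (2 * ε) * G ^ (1 + 3 * ε)) := by
          have e1 : (2 : ℝ) ^ (1 + ε) ≤ 4 := by
            calc (2 : ℝ) ^ (1 + ε) ≤ 2 ^ (2 : ℝ) :=
                  Real.rpow_le_rpow_of_exponent_le (by norm_num) (by linarith)
              _ = 4 := by norm_num
          have e2 : q ^ (1 + ε) ≤ q * P ^ ε := by
            rw [Real.rpow_add hq0, Real.rpow_one]
            exact mul_le_mul_of_nonneg_left (Real.rpow_le_rpow hq0.le hqP hε.le) hq0.le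
          have e3 : P ^ (ε * (1 + ε)) ≤ P ^ (2 * ε) :=
            Real.rpow_le_rpow_of_exponent_le hP (by nlinarith)
          have e4 : G ^ ((1 + ε) * (1 + ε)) ≤ G ^ (1 + 3 * ε) :=
            Real.rpow_le_rpow_of_exponent_le hG (by nlinarith)
          exact mul_le_mul e1 (mul_le_mul (mul_le_mul e2 e3 (by positivity) (by positivity)) e4
            (by positivity) (by positivity)) (by positivity) (by norm_num)
      _ = _ := by ring
  calc varIndex a i r ≤ q * P ^ ε * (A + 1) ^ (1 + ε) := h1
    _ ≤ q * P ^ ε * (4 * (q * P ^ ε) * P ^ (2 * ε) * G ^ (1 + 3 * ε)) := by gcongr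
    _ = 4 * q ^ 2 * (P ^ ε * P ^ ε * P ^ (2 * ε)) * G ^ (1 + 3 * ε) := by ring
    _ = _ := by
      rw [← Real.rpow_add hP0, ← Real.rpow_add hP0]
      ring_nf

include ha

/-- A Wiman type inequality for the majorant. -/
theorem majorant_le_of_notMem (hp : 1 ≤ p) :
    majorant a r ≤ 2 * (3 * √(8 * p)) ^ p * (maxTerm a r * density r ^ (1 + 2 * p * ε) *
      logMajorant a c r ^ (p * (1 + 3 * ε) / 2)) := by
  have hG := one_le_logMajorant hc hS
  have hP := one_le_density hr.1
  have hG0 : 0 < logMajorant a c r := by linarith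
  have hP0 : 0 < density r := by linarith
  have hq0 : ∀ i, 0 < 1 / (1 - r i) := fun i => by linarith [one_le_one_div_one_sub hr.1 i]
  have hS0 : 0 < majorant a r := hc.trans_le hS
  have h0 : ∀ j, 0 ≤ r j := fun j => (hr.1 j).1
  have h := total_le_of_variance_le hp (summable_weight ha hr.1).hasSum (weight_nonneg a h0)
    (weight_le_maxTerm ha hr.1) (A := fun i => meanIndex a i r) (meanIndex_nonneg a h0)
    (V := fun i => varIndex a i r) (fun i => ?_)
    (varIndex_le_of_notMem hc hε hε1 hr hS hirr) (fun i => ?_)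
  · refine h.trans_eq ?_
    -- The variance bound is 4 times a perfect square, so its root contributes one factor 1/(1 -
    -- r_i). The product over i then produces one full power of the density.
    have h1 : ∀ i, 3 * √(2 * p * (4 * (1 / (1 - r i)) ^ 2 * density r ^ (4 * ε) *
        logMajorant a c r ^ (1 + 3 * ε))) = (3 * √(8 * p)) * (1 / (1 - r i)) *
        (density r ^ (2 * ε) * logMajorant a c r ^ ((1 + 3 * ε) / 2)) := by
      intro i
      have h2 : density r ^ (4 * ε) = (density r ^ (2 * ε)) ^ 2 := by
        rw [← Real.rpow_mul_natCast hP0.le]; congr 1; push_cast; ring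
      have h3 : logMajorant a c r ^ (1 + 3 * ε) = (logMajorant a c r ^ ((1 + 3 * ε) / 2)) ^ 2 := by
        rw [← Real.rpow_mul_natCast hG0.le]; congr 1; push_cast; ring
      rw [h2, h3, show 2 * (p : ℝ) * (4 * (1 / (1 - r i)) ^ 2 * (density r ^ (2 * ε)) ^ 2 *
        (logMajorant a c r ^ ((1 + 3 * ε) / 2)) ^ 2) = 8 * p * ((1 / (1 - r i)) *
        (density r ^ (2 * ε) * logMajorant a c r ^ ((1 + 3 * ε) / 2))) ^ 2 by ring,
        Real.sqrt_mul (by positivity), Real.sqrt_sq (by have := hq0 i; positivity)]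
      ring
    rw [Finset.prod_congr rfl fun i _ => h1 i, Finset.prod_mul_distrib, Finset.prod_mul_distrib,
      Finset.prod_const, Finset.prod_const, Finset.card_univ, Fintype.card_fin, ← density,
      mul_pow (density r ^ (2 * ε)), ← Real.rpow_mul_natCast hP0.le,
      ← Real.rpow_mul_natCast hG0.le, Real.rpow_add hP0, Real.rpow_one,
      show 2 * ε * p = 2 * p * ε by ring, show (1 + 3 * ε) / 2 * p = p * (1 + 3 * ε) / 2 by ring]
    ring
  · exact tsum_sq_sub_mul (x := fun n : Fin p → ℕ => (n i : ℝ)) (summable_weight ha hr.1)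
      (summable_index_mul_weight ha i hr.1) (summable_index_sq_mul_weight ha i hr.1) hS0.ne'
  · have h1 := one_le_pow₀ (one_le_one_div_one_sub hr.1 i) (n := 2)
    have h2 := Real.one_le_rpow hP (show 0 ≤ 4 * ε by linarith)
    have h3 := Real.one_le_rpow hG (show 0 ≤ 1 + 3 * ε by linarith)
    have h4 := one_le_mul_of_one_le_of_one_le (one_le_mul_of_one_le_of_one_le h1 h2) h3
    calc (1 : ℝ) ≤ 4 * ((1 / (1 - r i)) ^ 2 * density r ^ (4 * ε) *
        logMajorant a c r ^ (1 + 3 * ε)) := by linarith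
      _ = _ := by ring

end Regular

/-- A power bound for `S` in terms of `ln S` can be turned into a bound by the logarithm of the
main term. -/
theorem exists_log_le_mul_log {c C κ₁ κ₂ : ℝ} (hc : 0 < c) (hC : 0 < C) (hκ₁ : 1 ≤ κ₁)
    (hκ₂ : 0 ≤ κ₂) : ∃ K > 0, ∀ μ P S : ℝ, c ≤ μ → 1 ≤ P → c ≤ S → 1 ≤ Real.log (μ * P) →
      S ≤ C * (μ * P ^ κ₁ * (Real.log (S / c) + 1) ^ κ₂) →
      Real.log (S / c) + 1 ≤ K * Real.log (μ * P) := by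
  set D := |Real.log C - Real.log c + 1 + κ₂ * Real.log (2 * κ₂ + 1) - (κ₁ - 1) * Real.log c|
  refine ⟨2 * (κ₁ + D), by positivity, fun μ P S hμ hP hS hL h => ?_⟩
  have hS0 := hc.trans_le hS
  have hμ0 := hc.trans_le hμ
  have hP0 : 0 < P := by linarith
  have hG : 1 ≤ Real.log (S / c) + 1 := by
    have := Real.log_nonneg ((one_le_div hc).2 hS)
    linarith
  have hGS : Real.log (S / c) + 1 = Real.log S - Real.log c + 1 := by
    rw [Real.log_div hS0.ne' hc.ne']
  set G := Real.log (S / c) + 1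
  have hG0 : 0 < G := by linarith
  have h1 : Real.log S ≤ Real.log C + (Real.log μ + κ₁ * Real.log P + κ₂ * Real.log G) := by
    have := Real.log_le_log hS0 h
    rwa [Real.log_mul hC.ne' (by positivity), Real.log_mul (by positivity) (by positivity),
      Real.log_mul (by positivity) (by positivity), Real.log_rpow hP0, Real.log_rpow hG0] at this
  -- From ln x ≤ x - 1 at x = G/(2κ₂+1). The scaling makes κ₂ ln G at most G/2 plus a constant, so
  -- that G can be absorbed on the left.
  have h2 : Real.log G ≤ G / (2 * κ₂ + 1) + Real.log (2 * κ₂ + 1) := by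
    have := Real.log_le_sub_one_of_pos (show 0 < G / (2 * κ₂ + 1) by positivity)
    rw [Real.log_div hG0.ne' (by positivity)] at this
    linarith
  have h3 : κ₂ * Real.log G ≤ G / 2 + κ₂ * Real.log (2 * κ₂ + 1) := by
    have h4 : κ₂ * (G / (2 * κ₂ + 1)) ≤ G / 2 := by
      rw [mul_div_assoc', div_le_div_iff₀ (by positivity) two_pos]
      nlinarith
    have := mul_le_mul_of_nonneg_left h2 hκ₂
    linarith
  have h5 := Real.log_le_log hc hμ
  have h6 : Real.log (μ * P) = Real.log μ + Real.log P := Real.log_mul hμ0.ne' hP0.ne'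
  have h7 : (κ₁ - 1) * Real.log c ≤ (κ₁ - 1) * Real.log μ :=
    mul_le_mul_of_nonneg_left h5 (by linarith)
  have h8 := le_abs_self
    (Real.log C - Real.log c + 1 + κ₂ * Real.log (2 * κ₂ + 1) - (κ₁ - 1) * Real.log c)
  have h9 : D ≤ D * Real.log (μ * P) := le_mul_of_one_le_right (abs_nonneg _) hL
  have h10 : κ₁ * Real.log (μ * P) = κ₁ * Real.log μ + κ₁ * Real.log P := by rw [h6]; ring
  linarith

/-! ### Gaussian tails for multiplicative systems. -/

section Subgaussian

variable {ι : Type*} {X : ι → unitInterval → ℝ}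

/-- By convexity, e^(αx) ≤ cosh α + x sinh α for |x| ≤ 1. In the expanded product every term
containing some X_n integrates to zero, which leaves the product of the cosh α_n, and cosh α ≤
e^(α²/2). Multiplicativity thus does the work of independence. -/
theorem integral_exp_finset_sum_le (hX : IsMultiplicativeSystem X) (hm : ∀ n, Measurable (X n))
    (h1 : ∀ n t, |X n t| ≤ 1) (α : ι → ℝ) (s : Finset ι) :
    ∫ t, Real.exp (∑ n ∈ s, α n * X n t) ≤ Real.exp ((∑ n ∈ s, α n ^ 2) / 2) := by
  classical
  have hexp : ∀ t, Real.exp (∑ n ∈ s, α n * X n t) ≤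
      ∑ u ∈ s.powerset, (∏ n ∈ u, X n t) *
        ((∏ n ∈ u, Real.sinh (α n)) * ∏ n ∈ s \ u, Real.cosh (α n)) := by
    intro t
    calc Real.exp (∑ n ∈ s, α n * X n t) = ∏ n ∈ s, Real.exp (X n t * α n) := by
          rw [Real.exp_sum]; exact Finset.prod_congr rfl fun n _ => by rw [mul_comm]
      _ ≤ ∏ n ∈ s, (X n t * Real.sinh (α n) + Real.cosh (α n)) :=
          Finset.prod_le_prod (fun _ _ => (Real.exp_pos _).le) fun n _ => by
            rw [add_comm]; exact Real.exp_mul_le_cosh_add_mul_sinh (h1 n t) _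
      _ = _ := by
          rw [Finset.prod_add]
          exact Finset.sum_congr rfl fun u _ => by rw [Finset.prod_mul_distrib, mul_assoc]
  have hint : ∀ u : Finset ι, Integrable (fun t => ∏ n ∈ u, X n t) := by
    intro u
    rcases u.eq_empty_or_nonempty with rfl | hu
    · simp
    · exact hX.integrable_prod u hu
  have hbd : ∀ t, |∑ n ∈ s, α n * X n t| ≤ ∑ n ∈ s, |α n| := fun t =>
    (Finset.abs_sum_le_sum_abs _ _).trans (Finset.sum_le_sum fun n _ => by
      rw [abs_mul]; exact mul_le_of_le_one_right (abs_nonneg _) (h1 n t))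
  have hmeas : Measurable fun t => Real.exp (∑ n ∈ s, α n * X n t) := by fun_prop
  have hiexp : Integrable fun t => Real.exp (∑ n ∈ s, α n * X n t) :=
    Integrable.of_bound hmeas.aestronglyMeasurable (Real.exp (∑ n ∈ s, |α n|))
      (ae_of_all _ fun t => by
        rw [Real.norm_of_nonneg (Real.exp_pos _).le]
        exact Real.exp_le_exp.2 ((le_abs_self _).trans (hbd t)))
  calc ∫ t, Real.exp (∑ n ∈ s, α n * X n t)
      ≤ ∫ t, ∑ u ∈ s.powerset, (∏ n ∈ u, X n t) *
        ((∏ n ∈ u, Real.sinh (α n)) * ∏ n ∈ s \ u, Real.cosh (α n)) :=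
        integral_mono hiexp (integrable_finsetSum _ fun u _ => (hint u).mul_const _) hexp
    _ = ∑ u ∈ s.powerset, (∫ t, ∏ n ∈ u, X n t) *
        ((∏ n ∈ u, Real.sinh (α n)) * ∏ n ∈ s \ u, Real.cosh (α n)) := by
        rw [integral_finsetSum _ fun u _ => (hint u).mul_const _]
        exact Finset.sum_congr rfl fun u _ => integral_mul_const _ _
    _ = ∏ n ∈ s, Real.cosh (α n) := by
        rw [Finset.sum_eq_single_of_mem ∅ (Finset.empty_mem_powerset s) fun u _ hu => by
          rw [hX.integral_prod u (Finset.nonempty_iff_ne_empty.2 hu), zero_mul]]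
        simp
    _ ≤ ∏ n ∈ s, Real.exp (α n ^ 2 / 2) :=
        Finset.prod_le_prod (fun n _ => (Real.cosh_pos _).le) fun n _ => Real.cosh_le_exp_half_sq _
    _ = Real.exp ((∑ n ∈ s, α n ^ 2) / 2) := by rw [← Real.exp_sum, Finset.sum_div]

theorem summable_mul_of_abs_le_one {α x : ι → ℝ} (hα : Summable fun n => |α n|)
    (hx : ∀ n, |x n| ≤ 1) : Summable fun n => α n * x n :=
  Summable.of_norm_bounded hα fun n => by
    rw [Real.norm_eq_abs, abs_mul]; exact mul_le_of_le_one_right (abs_nonneg _) (hx n)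

theorem integrable_exp_tsum [Countable ι] (hm : ∀ n, Measurable (X n)) (h1 : ∀ n t, |X n t| ≤ 1)
    {α : ι → ℝ} (hα : Summable fun n => |α n|) :
    Integrable fun t => Real.exp (∑' n, α n * X n t) := by
  have hmeas : Measurable fun t => Real.exp (∑' n, α n * X n t) := by fun_prop
  refine Integrable.of_bound hmeas.aestronglyMeasurable (Real.exp (∑' n, |α n|))
    (ae_of_all _ fun t => ?_)
  rw [Real.norm_of_nonneg (Real.exp_pos _).le]
  exact Real.exp_le_exp.2 (Summable.tsum_le_tsum (fun n => (le_abs_self _).trans (by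
    rw [abs_mul]; exact mul_le_of_le_one_right (abs_nonneg _) (h1 n t)))
    (summable_mul_of_abs_le_one hα fun n => h1 n t) hα)

theorem integral_exp_tsum_le [Countable ι] (hX : IsMultiplicativeSystem X)
    (hm : ∀ n, Measurable (X n)) (h1 : ∀ n t, |X n t| ≤ 1) {α : ι → ℝ}
    (hα : Summable fun n => |α n|) {V : ℝ} (hV : ∀ s : Finset ι, ∑ n ∈ s, α n ^ 2 ≤ V) :
    ∫ t, Real.exp (∑' n, α n * X n t) ≤ Real.exp (V / 2) := by
  have hlim := tendsto_integral_filter_of_dominated_convergence (μ := volume)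
    (l := (atTop : Filter (Finset ι)))
    (F := fun s t => Real.exp (∑ n ∈ s, α n * X n t))
    (f := fun t => Real.exp (∑' n, α n * X n t)) (fun _ => Real.exp (∑' n, |α n|))
    (Eventually.of_forall fun s => by
      have : Measurable fun t => Real.exp (∑ n ∈ s, α n * X n t) := by fun_prop
      exact this.aestronglyMeasurable)
    (Eventually.of_forall fun s => ae_of_all _ fun t => by
      rw [Real.norm_of_nonneg (Real.exp_pos _).le]
      refine Real.exp_le_exp.2 (le_trans (Finset.sum_le_sum fun n _ => ?_)
        (hα.sum_le_tsum s fun n _ => abs_nonneg _))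
      refine (le_abs_self _).trans ?_
      rw [abs_mul]
      exact mul_le_of_le_one_right (abs_nonneg _) (h1 n t))
    (integrable_const _)
    (ae_of_all _ fun t => (Real.continuous_exp.tendsto _).comp
      (summable_mul_of_abs_le_one hα fun n => h1 n t).hasSum)
  refine le_of_tendsto' hlim fun s => (integral_exp_finset_sum_le hX hm h1 α s).trans ?_
  exact Real.exp_le_exp.2 (by linarith [hV s])

theorem measureReal_le_tsum_le [Countable ι] (hX : IsMultiplicativeSystem X)
    (hm : ∀ n, Measurable (X n)) (h1 : ∀ n t, |X n t| ≤ 1) {α : ι → ℝ}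
    (hα : Summable fun n => |α n|) {V : ℝ} (hV0 : 0 < V)
    (hV : ∀ s : Finset ι, ∑ n ∈ s, α n ^ 2 ≤ V) {s : ℝ} (hs : 0 ≤ s) :
    (volume : Measure unitInterval).real {t | s * √V ≤ ∑' n, α n * X n t} ≤
      Real.exp (-(s ^ 2 / 2)) := by
  have hsq := Real.sqrt_pos.2 hV0
  -- The optimal Chernoff parameter: the exponent becomes -s² + s²/2.
  set l := s / √V with hl
  have hl0 : 0 ≤ l := by positivity
  have hlα : Summable fun n => |l * α n| := by
    simpa only [abs_mul] using hα.mul_left |l|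
  have hmul : ∀ t, l * ∑' n, α n * X n t = ∑' n, (l * α n) * X n t := fun t => by
    rw [← tsum_mul_left]; exact tsum_congr fun n => by ring
  have hl2 : l ^ 2 * V = s ^ 2 := by
    rw [hl, div_pow, Real.sq_sqrt hV0.le]; field_simp
  have hint := integrable_exp_tsum hm h1 hlα
  have hle := integral_exp_tsum_le hX hm h1 hlα (V := s ^ 2) fun u => by
    rw [← hl2]
    simp only [mul_pow, ← Finset.mul_sum]
    exact mul_le_mul_of_nonneg_left (hV u) (sq_nonneg _)
  simp only [← hmul] at hint hle
  refine (ProbabilityTheory.measure_ge_le_exp_mul_mgf _ hl0 hint).trans ?_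
  calc Real.exp (-l * (s * √V)) * _ ≤ Real.exp (-l * (s * √V)) * Real.exp (s ^ 2 / 2) :=
        mul_le_mul_of_nonneg_left hle (Real.exp_pos _).le
    _ = Real.exp (-(s ^ 2 / 2)) := by
        rw [← Real.exp_add]
        congr 1
        have : l * (s * √V) = s ^ 2 := by rw [hl]; field_simp
        linarith

theorem measureReal_le_abs_tsum_le [Countable ι] (hX : IsMultiplicativeSystem X)
    (hm : ∀ n, Measurable (X n)) (h1 : ∀ n t, |X n t| ≤ 1) {α : ι → ℝ}
    (hα : Summable fun n => |α n|) {V : ℝ} (hV0 : 0 < V)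
    (hV : ∀ s : Finset ι, ∑ n ∈ s, α n ^ 2 ≤ V) {s : ℝ} (hs : 0 ≤ s) :
    (volume : Measure unitInterval).real {t | s * √V ≤ |∑' n, α n * X n t|} ≤
      2 * Real.exp (-(s ^ 2 / 2)) := by
  have hpos := measureReal_le_tsum_le hX hm h1 hα hV0 hV hs
  have hneg := measureReal_le_tsum_le hX hm h1 (α := fun n => -α n) (by simpa using hα) hV0
    (by simpa using hV) hs
  have hsub : {t | s * √V ≤ |∑' n, α n * X n t|} ⊆
      {t | s * √V ≤ ∑' n, α n * X n t} ∪ {t | s * √V ≤ ∑' n, -α n * X n t} := by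
    intro t ht
    rcases le_abs.1 (show s * √V ≤ |∑' n, α n * X n t| from ht) with h | h
    · exact Or.inl h
    · refine Or.inr ?_
      rw [mem_ofPred_eq]
      simpa only [neg_mul, tsum_neg] using h
  linarith [measureReal_mono (μ := (volume : Measure unitInterval)) hsub, measureReal_union_le (μ := (volume : Measure unitInterval))
    {t | s * √V ≤ ∑' n, α n * X n t} {t | s * √V ≤ ∑' n, -α n * X n t}]

/-- The tail estimate for complex multiplicative systems. -/
theorem measureReal_le_norm_tsum_le [Countable ι] {Z : ι → unitInterval → ℂ}
    (hZ : IsComplexMultiplicativeSystem Z) (hm : ∀ n, Measurable (Z n))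
    (h1 : ∀ n t, ‖Z n t‖ ≤ 1) {c : ι → ℂ} (hc : Summable fun n => ‖c n‖) {V : ℝ} (hV0 : 0 < V)
    (hV : ∀ s : Finset ι, ∑ n ∈ s, ‖c n‖ ^ 2 ≤ V) {s : ℝ} (hs : 0 ≤ s) :
    (volume : Measure unitInterval).real {t | 4 * (s * √V) ≤ ‖∑' n, c n * Z n t‖} ≤
      8 * Real.exp (-(s ^ 2 / 2)) := by
  have hre : Summable fun n => |(c n).re| :=
    Summable.of_nonneg_of_le (fun _ => abs_nonneg _) (fun n => Complex.abs_re_le_norm _) hc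
  have him : Summable fun n => |(c n).im| :=
    Summable.of_nonneg_of_le (fun _ => abs_nonneg _) (fun n => Complex.abs_im_le_norm _) hc
  have hVre : ∀ s : Finset ι, ∑ n ∈ s, (c n).re ^ 2 ≤ V := fun s =>
    (Finset.sum_le_sum fun n _ => by
      rw [← sq_abs]; exact pow_le_pow_left₀ (abs_nonneg _) (Complex.abs_re_le_norm _) 2).trans (hV s)
  have hVim : ∀ s : Finset ι, ∑ n ∈ s, (c n).im ^ 2 ≤ V := fun s =>
    (Finset.sum_le_sum fun n _ => by
      rw [← sq_abs]; exact pow_le_pow_left₀ (abs_nonneg _) (Complex.abs_im_le_norm _) 2).trans (hV s)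
  have hX1 : ∀ n t, |(Z n t).re| ≤ 1 := fun n t => (Complex.abs_re_le_norm _).trans (h1 n t)
  have hY1 : ∀ n t, |(Z n t).im| ≤ 1 := fun n t => (Complex.abs_im_le_norm _).trans (h1 n t)
  have hXm : ∀ n, Measurable fun t => (Z n t).re := fun n => Complex.measurable_re.comp (hm n)
  have hYm : ∀ n, Measurable fun t => (Z n t).im := fun n => Complex.measurable_im.comp (hm n)
  have e1 := measureReal_le_abs_tsum_le hZ.1 hXm hX1 hre hV0 hVre hs
  have e2 := measureReal_le_abs_tsum_le hZ.2 hYm hY1 him hV0 hVim hs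
  have e3 := measureReal_le_abs_tsum_le hZ.2 hYm hY1 hre hV0 hVre hs
  have e4 := measureReal_le_abs_tsum_le hZ.1 hXm hX1 him hV0 hVim hs
  -- The product c_n Z_n splits into four real series, each involving only the real or only the
  -- imaginary parts of Z, so no joint property of the two systems is needed. This accounts for the
  -- 4 in the threshold and for 8 = 4 · 2 in the bound.
  set E1 := {t | s * √V ≤ |∑' n, (c n).re * (Z n t).re|}
  set E2 := {t | s * √V ≤ |∑' n, (c n).im * (Z n t).im|}
  set E3 := {t | s * √V ≤ |∑' n, (c n).re * (Z n t).im|}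
  set E4 := {t | s * √V ≤ |∑' n, (c n).im * (Z n t).re|}
  have hsub : {t | 4 * (s * √V) ≤ ‖∑' n, c n * Z n t‖} ⊆ (E1 ∪ E2) ∪ (E3 ∪ E4) := by
    intro t ht
    have ht' : 4 * (s * √V) ≤ ‖∑' n, c n * Z n t‖ := ht
    have hsum : Summable fun n => c n * Z n t := Summable.of_norm_bounded hc fun n => by
      rw [norm_mul]; exact mul_le_of_le_one_right (norm_nonneg _) (h1 n t)
    have hR : (∑' n, c n * Z n t).re =
        (∑' n, (c n).re * (Z n t).re) - ∑' n, (c n).im * (Z n t).im := by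
      rw [Complex.re_tsum hsum, ← (summable_mul_of_abs_le_one hre fun n => hX1 n t).tsum_sub
        (summable_mul_of_abs_le_one him fun n => hY1 n t)]
      exact tsum_congr fun n => Complex.mul_re _ _
    have hI : (∑' n, c n * Z n t).im =
        (∑' n, (c n).re * (Z n t).im) + ∑' n, (c n).im * (Z n t).re := by
      rw [Complex.im_tsum hsum, ← (summable_mul_of_abs_le_one hre fun n => hY1 n t).tsum_add
        (summable_mul_of_abs_le_one him fun n => hX1 n t)]
      exact tsum_congr fun n => Complex.mul_im _ _
    by_contra hcon
    simp only [E1, E2, E3, E4, mem_union, not_or, mem_ofPred_eq, not_le] at hcon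
    obtain ⟨⟨n1, n2⟩, n3, n4⟩ := hcon
    have h := Complex.norm_le_abs_re_add_abs_im (∑' n, c n * Z n t)
    rw [hR, hI] at h
    have h5 := abs_sub (∑' n, (c n).re * (Z n t).re) (∑' n, (c n).im * (Z n t).im)
    have h6 := abs_add_le (∑' n, (c n).re * (Z n t).im) (∑' n, (c n).im * (Z n t).re)
    linarith
  linarith [measureReal_mono (μ := (volume : Measure unitInterval)) hsub,
    measureReal_union_le (μ := (volume : Measure unitInterval)) (E1 ∪ E2) (E3 ∪ E4),
    measureReal_union_le (μ := (volume : Measure unitInterval)) E1 E2,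
    measureReal_union_le (μ := (volume : Measure unitInterval)) E3 E4]

/-- Keeping the k-th term of the exponential series turns the Gaussian tail into a power decay of
any chosen order. -/
theorem exp_neg_sq_half_le {s : ℝ} (hs : 0 < s) (k : ℕ) :
    Real.exp (-(s ^ 2 / 2)) ≤ k.factorial * 2 ^ k / s ^ (2 * k) := by
  have h := Real.pow_div_factorial_le_exp (s ^ 2 / 2) (by positivity) k
  rw [Real.exp_neg, inv_le_comm₀ (Real.exp_pos _) (by positivity)]
  refine le_trans (le_of_eq ?_) h
  rw [div_pow, ← pow_mul]
  field_simp

end Subgaussian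

/-! ### Finite nets in the closed polydisc. -/

section Net

/-- Rounding towards zero, so that the lattice point attached to a point of the disc stays in the
disc. -/
theorem exists_int_div_near {m : ℕ} (hm : 0 < m) (x : ℝ) :
    ∃ k : ℤ, |(k : ℝ) / m| ≤ |x| ∧ |x - k / m| ≤ 1 / m := by
  have hm' : (0 : ℝ) < m := by exact_mod_cast hm
  have key : ∀ y : ℝ, 0 ≤ y → ∃ k : ℤ, |(k : ℝ) / m| ≤ |y| ∧ |y - k / m| ≤ 1 / m := by
    intro y hy
    have h1 := Int.floor_le (y * m)
    have h2 := Int.lt_floor_add_one (y * m)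
    have h0 : (0 : ℝ) ≤ ⌊y * m⌋ := by exact_mod_cast Int.floor_nonneg.2 (by positivity)
    refine ⟨⌊y * m⌋, ?_, ?_⟩
    · rw [abs_of_nonneg (by positivity), abs_of_nonneg hy]
      exact (div_le_iff₀ hm').2 h1
    · have h3 : y - ⌊y * m⌋ / m = (y * m - ⌊y * m⌋) / m := by field_simp
      rw [h3, abs_of_nonneg (div_nonneg (by linarith) hm'.le)]
      exact div_le_div_of_nonneg_right (by linarith) hm'.le
  rcases le_total 0 x with hx | hx
  · exact key x hx
  · obtain ⟨k, h1, h2⟩ := key (-x) (by linarith)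
    refine ⟨-k, ?_, ?_⟩
    · push_cast; rwa [neg_div, abs_neg, ← abs_neg x]
    · push_cast; rwa [neg_div, sub_neg_eq_add, ← abs_neg, neg_add]

/-- The points of the lattice of mesh `1 / m` that lie in the closed unit disc. -/
def discNet (m : ℕ) : Finset ℂ :=
  ((Finset.Icc (-m : ℤ) m ×ˢ Finset.Icc (-m : ℤ) m).image
    fun k => (⟨k.1 / m, k.2 / m⟩ : ℂ)).filter fun z => ‖z‖ ≤ 1

theorem card_discNet_le (m : ℕ) : (discNet m).card ≤ (2 * m + 1) ^ 2 := by
  refine (Finset.card_filter_le _ _).trans (Finset.card_image_le.trans (le_of_eq ?_))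
  rw [Finset.card_product, Int.card_Icc, sq]
  congr 1 <;> omega

theorem norm_le_one_of_mem_discNet {m : ℕ} {z : ℂ} (hz : z ∈ discNet m) : ‖z‖ ≤ 1 :=
  (Finset.mem_filter.1 hz).2

theorem exists_mem_discNet {m : ℕ} (hm : 0 < m) {z : ℂ} (hz : ‖z‖ ≤ 1) :
    ∃ w ∈ discNet m, ‖z - w‖ ≤ 2 / m := by
  have hm' : (0 : ℝ) < m := by exact_mod_cast hm
  obtain ⟨k, hk1, hk2⟩ := exists_int_div_near hm z.re
  obtain ⟨l, hl1, hl2⟩ := exists_int_div_near hm z.im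
  have hrange : ∀ (k : ℤ) (x : ℝ), |x| ≤ 1 → |(k : ℝ) / m| ≤ |x| → k ∈ Finset.Icc (-m : ℤ) m := by
    intro k x hx hk
    have h := hk.trans hx
    rw [abs_div, abs_of_pos hm', div_le_one hm', abs_le] at h
    exact Finset.mem_Icc.2 ⟨by exact_mod_cast h.1, by exact_mod_cast h.2⟩
  refine ⟨⟨k / m, l / m⟩, Finset.mem_filter.2 ⟨Finset.mem_image.2 ⟨(k, l), Finset.mem_product.2
    ⟨hrange k _ ((Complex.abs_re_le_norm z).trans hz) hk1,
      hrange l _ ((Complex.abs_im_le_norm z).trans hz) hl1⟩, rfl⟩, ?_⟩, ?_⟩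
  · refine le_trans ?_ hz
    rw [Complex.norm_def, Complex.norm_def]
    refine Real.sqrt_le_sqrt ?_
    rw [Complex.normSq_apply, Complex.normSq_apply, ← sq, ← sq, ← sq, ← sq]
    exact add_le_add (sq_le_sq.2 hk1) (sq_le_sq.2 hl1)
  · refine (Complex.norm_le_abs_re_add_abs_im _).trans ?_
    simp only [Complex.sub_re, Complex.sub_im]
    calc _ ≤ 1 / (m : ℝ) + 1 / m := add_le_add hk2 hl2
      _ = 2 / m := by ring

/-- The corresponding net in the closed unit polydisc. -/
def polyNet (p m : ℕ) : Finset (Fin p → ℂ) := Fintype.piFinset fun _ => discNet m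

theorem card_polyNet_le (p m : ℕ) : (polyNet p m).card ≤ (2 * m + 1) ^ (2 * p) := by
  rw [polyNet, Fintype.card_piFinset, Finset.prod_const, Finset.card_univ, Fintype.card_fin,
    pow_mul]
  exact Nat.pow_le_pow_left (card_discNet_le m) p

theorem exists_mem_polyNet {m : ℕ} (hm : 0 < m) {z : Fin p → ℂ} (hz : ∀ j, ‖z j‖ ≤ 1) :
    ∃ w ∈ polyNet p m, ∀ j, ‖z j - w j‖ ≤ 2 / m := by
  choose w hw hzw using fun j => exists_mem_discNet hm (hz j)
  exact ⟨w, Fintype.mem_piFinset.2 hw, hzw⟩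

/-- Telescoping: the factors are exchanged one at a time, all the others having norm at most 1. -/
theorem norm_prod_sub_prod_le {ι : Type*} (s : Finset ι) {f g : ι → ℂ} (hf : ∀ i, ‖f i‖ ≤ 1)
    (hg : ∀ i, ‖g i‖ ≤ 1) : ‖∏ i ∈ s, f i - ∏ i ∈ s, g i‖ ≤ ∑ i ∈ s, ‖f i - g i‖ := by
  classical
  induction s using Finset.induction_on with
  | empty => simp
  | insert a s has ih =>
    rw [Finset.prod_insert has, Finset.prod_insert has, Finset.sum_insert has]
    have hG : ‖∏ i ∈ s, g i‖ ≤ 1 := by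
      rw [norm_prod]; exact Finset.prod_le_one (fun _ _ => norm_nonneg _) fun i _ => hg i
    calc ‖f a * ∏ i ∈ s, f i - g a * ∏ i ∈ s, g i‖
        = ‖(f a - g a) * ∏ i ∈ s, g i + f a * (∏ i ∈ s, f i - ∏ i ∈ s, g i)‖ := by
          congr 1; ring
      _ ≤ ‖f a - g a‖ * ‖∏ i ∈ s, g i‖ + ‖f a‖ * ‖∏ i ∈ s, f i - ∏ i ∈ s, g i‖ := by
          rw [← norm_mul, ← norm_mul]; exact norm_add_le _ _
      _ ≤ ‖f a - g a‖ * 1 + 1 * ∑ i ∈ s, ‖f i - g i‖ := by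
          gcongr
          exact hf a
      _ = _ := by ring

theorem norm_monomial_sub_le {z w : Fin p → ℂ} (hz : ∀ j, ‖z j‖ ≤ 1) (hw : ∀ j, ‖w j‖ ≤ 1)
    {η : ℝ} (h : ∀ j, ‖z j - w j‖ ≤ η) (n : Fin p → ℕ) :
    ‖∏ j, z j ^ n j - ∏ j, w j ^ n j‖ ≤ η * ∑ j, (n j : ℝ) := by
  refine (norm_prod_sub_prod_le _ (fun j => ?_) fun j => ?_).trans ?_
  · rw [norm_pow]; exact pow_le_one₀ (norm_nonneg _) (hz j)
  · rw [norm_pow]; exact pow_le_one₀ (norm_nonneg _) (hw j)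
  · rw [Finset.mul_sum]
    refine Finset.sum_le_sum fun j _ => ?_
    have h1 := norm_prod_sub_prod_le (Finset.range (n j)) (f := fun _ => z j) (g := fun _ => w j)
      (fun _ => hz j) (fun _ => hw j)
    simp only [Finset.prod_const, Finset.card_range, Finset.sum_const, nsmul_eq_mul] at h1
    refine h1.trans ?_
    rw [mul_comm]
    exact mul_le_mul_of_nonneg_right (h j) (by positivity)

end Net

/-! ### Bounds for the random series that are uniform in t. -/

section RandomSeries

variable {a b : (Fin p → ℕ) → ℂ} {r : Fin p → ℝ}

theorem norm_term_le (hb : ∀ n, ‖b n‖ ≤ ‖a n‖) {z : Fin p → ℂ}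
    (hz : ∀ j, ‖z j‖ ≤ r j) (n : Fin p → ℕ) : ‖b n * ∏ j, z j ^ n j‖ ≤ weight a r n := by
  rw [norm_mul, norm_prod, weight]
  refine mul_le_mul (hb n) (Finset.prod_le_prod (fun _ _ => norm_nonneg _) fun j _ => ?_)
    (Finset.prod_nonneg fun _ _ => norm_nonneg _) (norm_nonneg _)
  rw [norm_pow]
  exact pow_le_pow_left₀ (norm_nonneg _) (hz j) _

theorem convergesInPolydisc_of_norm_le (ha : ConvergesInPolydisc a) (hb : ∀ n, ‖b n‖ ≤ ‖a n‖) :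
    ConvergesInPolydisc b := by
  intro z hz
  exact Summable.of_norm_bounded
    (summable_weight (r := fun j => ‖z j‖) ha fun j => ⟨norm_nonneg _, hz j⟩)
    (norm_term_le hb fun j => le_rfl)

theorem norm_scaled_le (hr : ∀ j, 0 ≤ r j) {ζ : Fin p → ℂ} (hζ : ∀ j, ‖ζ j‖ ≤ 1) (j : Fin p) :
    ‖(r j : ℂ) * ζ j‖ ≤ r j := by
  rw [norm_mul, Complex.norm_real, Real.norm_of_nonneg (hr j)]
  exact mul_le_of_le_one_right (hr j) (hζ j)

/-- A monomial of multidegree n is Lipschitz on the closed unit polydisc with constant the sum of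
the n_j. The resulting modulus of continuity involves only first moments of the majorant, hence is
independent of the random coefficients. -/
theorem norm_powerSum_sub_le (ha : ConvergesInPolydisc a) (hb : ∀ n, ‖b n‖ ≤ ‖a n‖)
    (hr : r ∈ cube p) {ζ ω : Fin p → ℂ} (hζ : ∀ j, ‖ζ j‖ ≤ 1) (hω : ∀ j, ‖ω j‖ ≤ 1) {η : ℝ}
    (h : ∀ j, ‖ζ j - ω j‖ ≤ η) :
    ‖powerSum b (fun j => r j * ζ j) - powerSum b (fun j => r j * ω j)‖ ≤
      η * ∑ i, ∑' n : Fin p → ℕ, n i * weight a r n := by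
  have h0 : ∀ j, 0 ≤ r j := fun j => (hr j).1
  have hs : ∀ ζ : Fin p → ℂ, (∀ j, ‖ζ j‖ ≤ 1) →
      Summable fun n : Fin p → ℕ => b n * ∏ j, ((r j : ℂ) * ζ j) ^ n j := fun ζ hζ =>
    Summable.of_norm_bounded (summable_weight ha hr) (norm_term_le hb (norm_scaled_le h0 hζ))
  have hbound : HasSum (fun n : Fin p → ℕ => η * ∑ i, n i * weight a r n)
      (η * ∑ i, ∑' n : Fin p → ℕ, n i * weight a r n) :=
    (hasSum_sum fun i _ => (summable_index_mul_weight ha i hr).hasSum).mul_left η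
  rw [powerSum, powerSum, ← (hs ζ hζ).tsum_sub (hs ω hω)]
  refine tsum_of_norm_bounded hbound fun n => ?_
  have e : ∀ ζ : Fin p → ℂ, b n * ∏ j, ((r j : ℂ) * ζ j) ^ n j =
      b n * (∏ j, (r j : ℂ) ^ n j) * ∏ j, ζ j ^ n j := fun ζ => by
    rw [mul_assoc, ← Finset.prod_mul_distrib]; simp only [mul_pow]
  have hw : ‖b n * ∏ j, (r j : ℂ) ^ n j‖ ≤ weight a r n :=
    norm_term_le hb (fun j => by rw [Complex.norm_real, Real.norm_of_nonneg (h0 j)]) n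
  rw [e, e, ← mul_sub, norm_mul, ← Finset.sum_mul]
  calc _ ≤ weight a r n * (η * ∑ j, (n j : ℝ)) :=
        mul_le_mul hw (norm_monomial_sub_le hζ hω h n) (norm_nonneg _) (weight_nonneg a h0 n)
    _ = _ := by ring

theorem norm_randomCoeff_le {Z : (Fin p → ℕ) → unitInterval → ℂ} {t : unitInterval}
    (h1 : ∀ n, ‖Z n t‖ ≤ 1) (n : Fin p → ℕ) : ‖randomCoeff a Z t n‖ ≤ ‖a n‖ := by
  rw [randomCoeff, norm_mul]
  exact mul_le_of_le_one_right (norm_nonneg _) (h1 n)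

end RandomSeries

/-! ### The random exceptional set. -/

/-- If the sections of a set `B` over the points `r` have probability `O(∏ (1 - r_j))`, then almost
all sections in the other direction have finite logarithmic measure. -/
theorem ae_logMeasure_section_lt_top {B : Set ((Fin p → ℝ) × unitInterval)} (hB : MeasurableSet B)
    {C : ℝ} (hsub : ∀ x ∈ B, x.1 ∈ halfCorner p)
    (h : ∀ r ∈ halfCorner p, volume {t | (r, t) ∈ B} ≤ ENNReal.ofReal (C / density r)) :
    ∀ᵐ t ∂(volume : Measure unitInterval), logMeasure {r | (r, t) ∈ B} < ⊤ := by
  set d : (Fin p → ℝ) → ENNReal := fun r => ∏ i, ENNReal.ofReal (1 / (1 - r i)) with hd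
  have hdm : Measurable d := by fun_prop
  set ν : Measure (Fin p → ℝ) := volume.withDensity d with hν
  have hlog : ∀ t : unitInterval, logMeasure {r | (r, t) ∈ B} = ν ((fun r => (r, t)) ⁻¹' B) :=
    fun t => (withDensity_apply _ (measurable_prodMk_right hB)).symm
  simp only [hlog]
  refine ae_lt_top (measurable_measure_prodMk_right hB) ?_
  rw [← Measure.prod_apply_symm hB, Measure.prod_apply hB, hν,
    lintegral_withDensity_eq_lintegral_mul _ hdm (measurable_measure_prodMk_left hB)]
  -- The density of the logarithmic measure cancels the bound C / `density`, leaving a constant on a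
  -- bounded set.
  have hle : ∀ r, (d * fun r => volume (Prod.mk r ⁻¹' B)) r ≤
      (halfCorner p).indicator (fun _ => ENNReal.ofReal C) r := by
    intro r
    simp only [Pi.mul_apply]
    by_cases hr : r ∈ halfCorner p
    · rw [indicator_of_mem hr]
      have hP := one_le_density hr.1
      have hdr : d r = ENNReal.ofReal (density r) :=
        (ENNReal.ofReal_prod_of_nonneg fun j _ =>
          zero_le_one.trans (one_le_one_div_one_sub hr.1 j)).symm
      calc d r * volume (Prod.mk r ⁻¹' B)
          ≤ ENNReal.ofReal (density r) * ENNReal.ofReal (C / density r) := by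
            rw [hdr]; exact mul_le_mul_right (h r hr) _
        _ = ENNReal.ofReal C := by
            rw [← ENNReal.ofReal_mul (by linarith)]
            congr 1
            field_simp
    · have : Prod.mk r ⁻¹' B = ∅ := by
        ext t
        simp only [mem_preimage, mem_empty_iff_false, iff_false]
        exact fun ht => hr (hsub _ ht)
      rw [this, measure_empty, mul_zero]
      exact zero_le
  refine ((lintegral_mono hle).trans_lt ?_).ne
  rw [lintegral_indicator_const (show MeasurableSet (halfCorner p) from measurableSet_corner _)]
  refine ENNReal.mul_lt_top ENNReal.ofReal_lt_top ?_
  refine (measure_mono (t := Icc 0 1) fun r hr => ?_).trans_lt isCompact_Icc.measure_lt_top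
  exact ⟨fun j => (hr.1 j).1, fun j => (hr.1 j).2.le⟩

/-- The product of the density and the logarithm of the majorant. -/
def scale (a : (Fin p → ℕ) → ℂ) (c : ℝ) (r : Fin p → ℝ) : ℝ := density r * logMajorant a c r

/-- The fineness of the net used at the point `r`. -/
def mesh (a : (Fin p → ℕ) → ℂ) (c : ℝ) (r : Fin p → ℝ) : ℕ := ⌈scale a c r ^ (2 * p + 3)⌉₊

/-- The pairs `(r, t)` for which `f(·, t)` is large at some point of the net. -/
def badSet (a : (Fin p → ℕ) → ℂ) (Z : (Fin p → ℕ) → unitInterval → ℂ) (c ε : ℝ) :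
    Set ((Fin p → ℝ) × unitInterval) :=
  {x | x.1 ∈ halfCorner p \ irregularSet a c ε ∧ ∃ ζ ∈ polyNet p (mesh a c x.1),
    4 * (scale a c x.1 ^ ε * √(maxTerm a x.1 * majorant a x.1)) ≤
      ‖powerSum (randomCoeff a Z x.2) fun j => x.1 j * ζ j‖}

@[fun_prop]
theorem measurable_scale (a : (Fin p → ℕ) → ℂ) (c : ℝ) : Measurable (scale a c) := by
  unfold scale; fun_prop

theorem measurableSet_badSet (a : (Fin p → ℕ) → ℂ) {Z : (Fin p → ℕ) → unitInterval → ℂ}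
    (hZ : ∀ n, Measurable (Z n)) (c ε : ℝ) : MeasurableSet (badSet a Z c ε) := by
  have hmesh : Measurable (mesh a c) := Nat.measurable_ceil.comp ((measurable_scale a c).pow_const _)
  have hF : ∀ ζ : Fin p → ℂ, Measurable fun x : (Fin p → ℝ) × unitInterval =>
      ‖powerSum (randomCoeff a Z x.2) fun j => x.1 j * ζ j‖ := by
    intro ζ
    unfold powerSum randomCoeff
    fun_prop
  have hG : Measurable fun x : (Fin p → ℝ) × unitInterval =>
      4 * (scale a c x.1 ^ ε * √(maxTerm a x.1 * majorant a x.1)) := by fun_prop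
  -- The net varies with r only through its integer mesh, so slicing by the mesh gives a countable
  -- union of finite unions.
  have heq : badSet a Z c ε = Prod.fst ⁻¹' (halfCorner p \ irregularSet a c ε) ∩
      ⋃ m : ℕ, ((fun x => mesh a c x.1) ⁻¹' {m} ∩ ⋃ ζ ∈ polyNet p m,
        {x | 4 * (scale a c x.1 ^ ε * √(maxTerm a x.1 * majorant a x.1)) ≤
          ‖powerSum (randomCoeff a Z x.2) fun j => x.1 j * ζ j‖}) := by
    ext x
    simp [badSet]
  rw [heq]
  exact (measurable_fst ((measurableSet_corner _).diff (measurableSet_irregularSet a c ε))).inter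
    (MeasurableSet.iUnion fun m => ((hmesh.comp measurable_fst) (measurableSet_singleton m)).inter
      (Finset.measurableSet_biUnion _ fun ζ _ => measurableSet_le hG (hF ζ)))

theorem one_le_scale {a : (Fin p → ℕ) → ℂ} {c : ℝ} (hc : 0 < c) {r : Fin p → ℝ} (hr : r ∈ cube p)
    (hS : c ≤ majorant a r) : 1 ≤ scale a c r :=
  one_le_mul_of_one_le_of_one_le (one_le_density hr) (one_le_logMajorant hc hS)

theorem density_rpow_mul_le_scale_rpow {a : (Fin p → ℕ) → ℂ} {c : ℝ} (hc : 0 < c) {r : Fin p → ℝ}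
    (hr : r ∈ cube p) (hS : c ≤ majorant a r) {x y : ℝ} {k : ℕ} (hx : x ≤ k) (hy : y ≤ k) :
    density r ^ x * logMajorant a c r ^ y ≤ scale a c r ^ k := by
  have hP := one_le_density hr
  have hG := one_le_logMajorant hc hS
  rw [scale, mul_pow, ← Real.rpow_natCast, ← Real.rpow_natCast]
  exact mul_le_mul (Real.rpow_le_rpow_of_exponent_le hP hx)
    (Real.rpow_le_rpow_of_exponent_le hG hy) (by positivity) (by positivity)

/-- A union bound: the net has O(D^((2p+3)·2p)) points, and each tail is made smaller than that by
one further factor D. What remains is O(1/D), and D is at least the density. -/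
theorem exists_volume_badSet_le {a : (Fin p → ℕ) → ℂ} (ha : ConvergesInPolydisc a)
    {Z : (Fin p → ℕ) → unitInterval → ℂ} (hZ : IsComplexMultiplicativeSystem Z)
    (hm : ∀ n, Measurable (Z n)) (h1 : ∀ n t, ‖Z n t‖ ≤ 1) {c ε : ℝ} (hc : 0 < c) (hε : 0 < ε)
    (hS : ∀ r ∈ halfCorner p, c ≤ majorant a r) (hμ : ∀ r ∈ halfCorner p, c ≤ maxTerm a r) :
    ∃ C : ℝ, ∀ r ∈ halfCorner p,
      volume {t | (r, t) ∈ badSet a Z c ε} ≤ ENNReal.ofReal (C / density r) := by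
  -- This makes 2kε at least (2p+3)·2p + 1, the decay needed at the threshold s = D^ε.
  obtain ⟨k, hk⟩ := exists_nat_ge ((((2 * p + 3) * (2 * p) + 1 : ℕ) : ℝ) / (2 * ε))
  refine ⟨5 ^ (2 * p) * (8 * (k.factorial * 2 ^ k)), fun r hr => ?_⟩
  by_cases hirr : r ∈ irregularSet a c ε
  · have : {t | (r, t) ∈ badSet a Z c ε} = ∅ := by
      ext t
      simp only [mem_ofPred_eq, mem_empty_iff_false, iff_false]
      exact fun ht => ht.1.2 hirr
    rw [this, measure_empty]
    exact zero_le
  have hD := one_le_scale hc hr.1 (hS r hr)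
  have hD0 : 0 < scale a c r := by linarith
  have h0 : ∀ j, 0 ≤ r j := fun j => (hr.1 j).1
  have hS0 := hc.trans_le (hS r hr)
  have hμ0 := hc.trans_le (hμ r hr)
  have hP := one_le_density hr.1
  have hPD : density r ≤ scale a c r :=
    le_mul_of_one_le_right (by linarith) (one_le_logMajorant hc (hS r hr))
  set D := scale a c r
  have hpoint : ∀ ζ ∈ polyNet p (mesh a c r), (volume : Measure unitInterval).real
      {t | 4 * (D ^ ε * √(maxTerm a r * majorant a r)) ≤
        ‖powerSum (randomCoeff a Z t) fun j => r j * ζ j‖} ≤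
      8 * (k.factorial * 2 ^ k) / D ^ ((2 * p + 3) * (2 * p) + 1) := by
    intro ζ hζ
    have hζ1 : ∀ j, ‖ζ j‖ ≤ 1 := fun j => norm_le_one_of_mem_discNet (Fintype.mem_piFinset.1 hζ j)
    have hterm := norm_term_le (a := a) (b := a) (fun _ => le_rfl) (norm_scaled_le h0 hζ1)
    have hsum : ∀ t, (powerSum (randomCoeff a Z t) fun j => r j * ζ j) =
        ∑' n : Fin p → ℕ, (a n * ∏ j, ((r j : ℂ) * ζ j) ^ n j) * Z n t := fun t =>
      tsum_congr fun n => by rw [randomCoeff]; ring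
    simp only [hsum]
    refine (measureReal_le_norm_tsum_le hZ hm h1 (Summable.of_nonneg_of_le
      (fun _ => norm_nonneg _) hterm (summable_weight ha hr.1)) (mul_pos hμ0 hS0) (fun s => ?_)
      (Real.rpow_nonneg hD0.le ε)).trans ?_
    -- One factor of each square is bounded by the maximal term and the other is summed. This is
    -- where μ times the majorant, rather than the square of the majorant, enters.
    · calc ∑ n ∈ s, ‖a n * ∏ j, ((r j : ℂ) * ζ j) ^ n j‖ ^ 2
          ≤ ∑ n ∈ s, maxTerm a r * weight a r n := Finset.sum_le_sum fun n _ => by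
            rw [sq]
            exact mul_le_mul ((hterm n).trans (weight_le_maxTerm ha hr.1 n)) (hterm n)
              (norm_nonneg _) hμ0.le
        _ ≤ maxTerm a r * majorant a r := by
            rw [← Finset.mul_sum]
            exact mul_le_mul_of_nonneg_left ((summable_weight ha hr.1).sum_le_tsum s
              fun n _ => weight_nonneg a h0 n) hμ0.le
    · rw [mul_div_assoc]
      refine mul_le_mul_of_nonneg_left ((exp_neg_sq_half_le (Real.rpow_pos_of_pos hD0 ε) k).trans
        (div_le_div_of_nonneg_left (by positivity) (by positivity) ?_)) (by norm_num)
      rw [← Real.rpow_mul_natCast hD0.le, ← Real.rpow_natCast]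
      refine Real.rpow_le_rpow_of_exponent_le hD ?_
      rw [div_le_iff₀ (by positivity)] at hk
      push_cast at hk ⊢
      linarith
  have hset : {t | (r, t) ∈ badSet a Z c ε} ⊆ ⋃ ζ ∈ polyNet p (mesh a c r),
      {t | 4 * (D ^ ε * √(maxTerm a r * majorant a r)) ≤
        ‖powerSum (randomCoeff a Z t) fun j => r j * ζ j‖} := by
    rintro t ⟨_, ζ, hζ, h⟩
    exact mem_iUnion₂.2 ⟨ζ, hζ, h⟩
  have hcard : ((polyNet p (mesh a c r)).card : ℝ) ≤ (5 * D ^ (2 * p + 3)) ^ (2 * p) := by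
    have h2 : ((polyNet p (mesh a c r)).card : ℝ) ≤ (2 * mesh a c r + 1) ^ (2 * p) := by
      exact_mod_cast card_polyNet_le p (mesh a c r)
    refine h2.trans (pow_le_pow_left₀ (by positivity) ?_ _)
    have h3 := (Nat.ceil_lt_add_one (show 0 ≤ D ^ (2 * p + 3) by positivity)).le
    have h4 : 1 ≤ D ^ (2 * p + 3) := one_le_pow₀ hD
    change (mesh a c r : ℝ) ≤ _ at h3
    linarith
  rw [← ofReal_measureReal]
  refine ENNReal.ofReal_le_ofReal ?_
  calc (volume : Measure unitInterval).real {t | (r, t) ∈ badSet a Z c ε}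
      ≤ ∑ ζ ∈ polyNet p (mesh a c r), (volume : Measure unitInterval).real
        {t | 4 * (D ^ ε * √(maxTerm a r * majorant a r)) ≤
          ‖powerSum (randomCoeff a Z t) fun j => r j * ζ j‖} :=
        (measureReal_mono hset (measure_ne_top _ _)).trans (measureReal_biUnion_finset_le _ _)
    _ ≤ (polyNet p (mesh a c r)).card •
          (8 * (k.factorial * 2 ^ k) / D ^ ((2 * p + 3) * (2 * p) + 1)) :=
        Finset.sum_le_card_nsmul _ _ _ hpoint
    _ ≤ (5 * D ^ (2 * p + 3)) ^ (2 * p) *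
          (8 * (k.factorial * 2 ^ k) / D ^ ((2 * p + 3) * (2 * p) + 1)) := by
        rw [nsmul_eq_mul]
        exact mul_le_mul_of_nonneg_right hcard (by positivity)
    _ = 5 ^ (2 * p) * (8 * (k.factorial * 2 ^ k)) / D := by
        rw [mul_pow, ← pow_mul, pow_succ]
        field_simp
    _ ≤ 5 ^ (2 * p) * (8 * (k.factorial * 2 ^ k)) / density r :=
        div_le_div_of_nonneg_left (by positivity) (by linarith) hPD

/-- Outside of the exceptional sets the maximum modulus is controlled by maximal term and
majorant. -/
theorem maxModulus_le_of_notMem_badSet (hp : 1 ≤ p) {a : (Fin p → ℕ) → ℂ}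
    (ha : ConvergesInPolydisc a) {Z : (Fin p → ℕ) → unitInterval → ℂ} {t : unitInterval}
    (h1 : ∀ n, ‖Z n t‖ ≤ 1) {c ε : ℝ} (hc : 0 < c) (hε : 0 < ε) (hε1 : ε ≤ 1) {r : Fin p → ℝ}
    (hr : r ∈ halfCorner p) (hS : c ≤ majorant a r) (hμ : c ≤ maxTerm a r)
    (hirr : r ∉ irregularSet a c ε) (hbad : (r, t) ∉ badSet a Z c ε) :
    maxModulus (randomCoeff a Z t) r ≤ 4 * (scale a c r ^ ε * √(maxTerm a r * majorant a r)) +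
      2 * p * (2 * (3 * √(8 * p)) ^ p) * maxTerm a r := by
  have hD := one_le_scale hc hr.1 hS
  have hP := one_le_density hr.1
  have hG := one_le_logMajorant hc hS
  have hS0 := hc.trans_le hS
  have hμ0 := hc.trans_le hμ
  have hmesh : scale a c r ^ (2 * p + 3) ≤ mesh a c r := Nat.le_ceil _
  have hmesh0 : (0 : ℝ) < mesh a c r := lt_of_lt_of_le (by positivity) hmesh
  have hp' : (1 : ℝ) ≤ p := by exact_mod_cast hp
  set C := 2 * (3 * √(8 * p)) ^ p with hC
  have hmaj := majorant_le_of_notMem ha hc hε hε1 hr hS hirr hp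
  have hmoment : ∀ i, ∑' n : Fin p → ℕ, n i * weight a r n ≤
      C * maxTerm a r * scale a c r ^ (2 * p + 3) := by
    intro i
    have h2 := meanIndex_le_of_notMem hc hr hS hirr i
    have h3 := one_div_one_sub_le_density hr.1 i
    have hP0 : 0 < density r := by linarith
    have hG0 : 0 < logMajorant a c r := by linarith
    calc ∑' n : Fin p → ℕ, n i * weight a r n = meanIndex a i r * majorant a r := by
          rw [meanIndex]; field_simp
      _ ≤ (density r * density r ^ ε * logMajorant a c r ^ (1 + ε)) *
          (C * (maxTerm a r * density r ^ (1 + 2 * p * ε) *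
            logMajorant a c r ^ (p * (1 + 3 * ε) / 2))) := by
          refine mul_le_mul (h2.trans ?_) hmaj hS0.le (by positivity)
          gcongr
      _ = C * maxTerm a r * ((density r * density r ^ ε * density r ^ (1 + 2 * p * ε)) *
          (logMajorant a c r ^ (1 + ε) * logMajorant a c r ^ (p * (1 + 3 * ε) / 2))) := by ring
      _ = C * maxTerm a r * (density r ^ (1 + ε + (1 + 2 * p * ε)) *
          logMajorant a c r ^ (1 + ε + p * (1 + 3 * ε) / 2)) := by
          rw [Real.rpow_add hP0 (1 + ε), Real.rpow_add hP0 1 ε, Real.rpow_one,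
            ← Real.rpow_add hG0]
      -- Since ε ≤ 1, the exponents are at most 2p + 3 and 2p + 2. This dictates the exponent 2p + 3
      -- in `mesh`.
      _ ≤ _ := by
          refine mul_le_mul_of_nonneg_left (density_rpow_mul_le_scale_rpow hc hr.1 hS ?_ ?_)
            (by positivity) <;> push_cast <;> nlinarith
  refine csSup_le ⟨_, mem_image_of_mem _ (x := 0) fun j => by simpa using (hr.1 j).1⟩ ?_
  rintro _ ⟨z, hz, rfl⟩
  have hrpos : ∀ j, 0 < r j := fun j => by linarith [(mem_halfCorner.1 hr j).1]
  -- Rescaling to the unit polydisc lets the net depend on r through its mesh alone.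
  set ζ : Fin p → ℂ := fun j => z j / r j with hζ
  have hζ1 : ∀ j, ‖ζ j‖ ≤ 1 := fun j => by
    rw [hζ, norm_div, Complex.norm_real, Real.norm_of_nonneg (hrpos j).le, div_le_one (hrpos j)]
    exact hz j
  have hzζ : z = fun j => (r j : ℂ) * ζ j := by
    ext j
    have : (r j : ℂ) ≠ 0 := by exact_mod_cast (hrpos j).ne'
    simp only [hζ]
    field_simp
  obtain ⟨ω, hω, hζω⟩ := exists_mem_polyNet (by exact_mod_cast hmesh0 : 0 < mesh a c r) hζ1
  have hω1 : ∀ j, ‖ω j‖ ≤ 1 := fun j => norm_le_one_of_mem_discNet (Fintype.mem_piFinset.1 hω j)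
  have hdiff := norm_powerSum_sub_le ha (norm_randomCoeff_le h1) hr.1 hζ1 hω1 hζω
  have hnet : ‖powerSum (randomCoeff a Z t) fun j => r j * ω j‖ ≤
      4 * (scale a c r ^ ε * √(maxTerm a r * majorant a r)) := by
    by_contra! h
    exact hbad ⟨⟨hr, hirr⟩, ω, hω, h.le⟩
  have hsmall : 2 / (mesh a c r : ℝ) * ∑ i, ∑' n : Fin p → ℕ, n i * weight a r n ≤
      2 * p * C * maxTerm a r := by
    calc _ ≤ 2 / (mesh a c r : ℝ) * ∑ i : Fin p, C * maxTerm a r * mesh a c r := by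
          refine mul_le_mul_of_nonneg_left (Finset.sum_le_sum fun i _ => (hmoment i).trans ?_)
            (by positivity)
          exact mul_le_mul_of_nonneg_left hmesh (by positivity)
      _ = _ := by
          rw [Finset.sum_const, Finset.card_univ, Fintype.card_fin, nsmul_eq_mul]
          field_simp
  have htri := norm_sub_norm_le (powerSum (randomCoeff a Z t) fun j => r j * ζ j)
    (powerSum (randomCoeff a Z t) fun j => r j * ω j)
  simp only [hzζ]
  linarith

/-! ### Exponent bookkeeping and assembly. -/

/-- The elementary estimate that turns the bound by maximal term and majorant into the final
form. -/
theorem exists_final_bound (hp : 1 ≤ p) {c ε δ : ℝ} (hc : 0 < c) (hε : 0 < ε)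
    (hεp : (p + 1) * ε ≤ δ / 4) (hε7 : 7 * ε ≤ δ) (hδ : 0 < δ) :
    ∃ R : ℝ, ∀ μ P S : ℝ, c ≤ μ → 1 ≤ P → R ≤ P → c ≤ S → 1 ≤ Real.log (μ * P) →
      S ≤ 2 * (3 * √(8 * p)) ^ p *
        (μ * P ^ (1 + 2 * p * ε) * (Real.log (S / c) + 1) ^ (p * (1 + 3 * ε) / 2)) →
      4 * ((P * (Real.log (S / c) + 1)) ^ ε * √(μ * S)) + 2 * p * (2 * (3 * √(8 * p)) ^ p) * μ ≤
        μ * (√P * Real.log (μ * P) ^ ((p : ℝ) / 4)) ^ (1 + δ) := by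
  have hp' : (1 : ℝ) ≤ p := by exact_mod_cast hp
  set C := 2 * (3 * √(8 * p)) ^ p with hC
  have hC0 : 0 < C := by positivity
  obtain ⟨K, hK, hlog⟩ := exists_log_le_mul_log (κ₁ := 1 + 2 * p * ε)
    (κ₂ := p * (1 + 3 * ε) / 2) hc hC0 (by nlinarith) (by positivity)
  -- The exponents of P and G in (PG)^ε √(μS), once S is replaced by its Wiman type bound.
  set x : ℝ := 1 / 2 + (p + 1) * ε with hx
  set y : ℝ := p * (1 + 3 * ε) / 4 + ε with hy
  have hy0 : 0 < y := by positivity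
  set C' := (4 * √C + 2 * p * C) * K ^ y with hC'
  have hC'0 : 0 < C' := by positivity
  refine ⟨C' ^ (4 / δ), fun μ P S hμ hP hR hS hL h => ?_⟩
  have hG := hlog μ P S hμ hP hS hL h
  have hG1 : 1 ≤ Real.log (S / c) + 1 := by
    have := Real.log_nonneg ((one_le_div hc).2 hS)
    linarith
  set G := Real.log (S / c) + 1
  set L := Real.log (μ * P)
  have hμ0 := hc.trans_le hμ
  have hS0 := hc.trans_le hS
  have hP0 : 0 < P := by linarith
  have hG0 : 0 < G := by linarith
  have hL0 : 0 < L := by linarith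
  have hsqrt : √(μ * S) ≤ √C * (μ * P ^ ((1 + 2 * p * ε) / 2) * G ^ (p * (1 + 3 * ε) / 4)) := by
    rw [← Real.sqrt_sq (show 0 ≤ μ * P ^ ((1 + 2 * p * ε) / 2) * G ^ (p * (1 + 3 * ε) / 4) by
      positivity), ← Real.sqrt_mul hC0.le]
    refine Real.sqrt_le_sqrt ?_
    have e1 : (P ^ ((1 + 2 * p * ε) / 2)) ^ 2 = P ^ (1 + 2 * p * ε) := by
      rw [← Real.rpow_mul_natCast hP0.le]; congr 1; push_cast; ring
    have e2 : (G ^ (p * (1 + 3 * ε) / 4)) ^ 2 = G ^ (p * (1 + 3 * ε) / 2) := by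
      rw [← Real.rpow_mul_natCast hG0.le]; congr 1; push_cast; ring
    rw [mul_pow, mul_pow, e1, e2]
    calc μ * S ≤ μ * (C * (μ * P ^ (1 + 2 * p * ε) * G ^ (p * (1 + 3 * ε) / 2))) :=
          mul_le_mul_of_nonneg_left h hμ0.le
      _ = _ := by ring
  have hmain : (P * G) ^ ε * √(μ * S) ≤ √C * (μ * P ^ x * G ^ y) := by
    calc (P * G) ^ ε * √(μ * S) ≤ (P ^ ε * G ^ ε) *
          (√C * (μ * P ^ ((1 + 2 * p * ε) / 2) * G ^ (p * (1 + 3 * ε) / 4))) := by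
          rw [Real.mul_rpow hP0.le hG0.le]
          exact mul_le_mul_of_nonneg_left hsqrt (by positivity)
      _ = √C * (μ * (P ^ ((1 + 2 * p * ε) / 2) * P ^ ε) *
          (G ^ (p * (1 + 3 * ε) / 4) * G ^ ε)) := by ring
      _ = _ := by
          rw [← Real.rpow_add hP0, ← Real.rpow_add hG0, hx, hy,
            show (1 + 2 * p * ε) / 2 + ε = 1 / 2 + (p + 1) * ε by ring]
  have hxy : μ ≤ μ * P ^ x * G ^ y := by
    rw [mul_assoc]
    exact le_mul_of_one_le_right hμ0.le (one_le_mul_of_one_le_of_one_le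
      (Real.one_le_rpow hP (by positivity)) (Real.one_le_rpow hG1 hy0.le))
  have hCP : C' ≤ P ^ (δ / 4) := by
    have := Real.rpow_le_rpow (by positivity) hR (show 0 ≤ δ / 4 by positivity)
    rwa [← Real.rpow_mul hC'0.le, show 4 / δ * (δ / 4) = 1 by field_simp, Real.rpow_one] at this
  calc 4 * ((P * G) ^ ε * √(μ * S)) + 2 * p * C * μ
      ≤ 4 * (√C * (μ * P ^ x * G ^ y)) + 2 * p * C * (μ * P ^ x * G ^ y) := by gcongr
    _ = (4 * √C + 2 * p * C) * (μ * P ^ x * G ^ y) := by ring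
    _ ≤ (4 * √C + 2 * p * C) * (μ * P ^ x * (K * L) ^ y) := by gcongr
    _ = C' * (μ * (P ^ x * L ^ y)) := by rw [Real.mul_rpow hK.le hL0.le, hC']; ring
    -- The target has P^(1/2+δ/2). One factor P^(δ/4) swallows the constant C', which is the role of
    -- R, and the other swallows P^((p+1)ε).
    _ ≤ P ^ (δ / 4) * (μ * (P ^ (1 / 2 + δ / 4) * L ^ ((p : ℝ) / 4 * (1 + δ)))) := by
        have e1 : P ^ x ≤ P ^ (1 / 2 + δ / 4) :=
          Real.rpow_le_rpow_of_exponent_le hP (by linarith)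
        have e2 : L ^ y ≤ L ^ ((p : ℝ) / 4 * (1 + δ)) :=
          Real.rpow_le_rpow_of_exponent_le hL (by rw [hy]; nlinarith)
        gcongr
    _ = μ * ((P ^ (δ / 4) * P ^ (1 / 2 + δ / 4)) * L ^ ((p : ℝ) / 4 * (1 + δ))) := by ring
    _ = _ := by
        rw [Real.mul_rpow (by positivity) (by positivity), ← Real.rpow_mul hL0.le,
          Real.sqrt_eq_rpow, ← Real.rpow_mul hP0.le, ← Real.rpow_add hP0]
        congr 3
        ring

theorem prod_one_div_sqrt (r : Fin p → ℝ) (hr : r ∈ cube p) :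
    ∏ j, 1 / √(1 - r j) = √(density r) := by
  rw [density, Real.sqrt_prod _ fun j _ =>
    zero_le_one.trans (one_le_one_div_one_sub hr j)]
  exact Finset.prod_congr rfl fun j _ => by rw [Real.sqrt_div zero_le_one, Real.sqrt_one]

/-- The theorem for measurable systems bounded by one everywhere. -/
theorem ae_maxModulus_le_of_measurable (hp : 1 ≤ p) {a : (Fin p → ℕ) → ℂ}
    (ha : ConvergesInPolydisc a) (ha0 : a ≠ 0) {Z : (Fin p → ℕ) → unitInterval → ℂ}
    (hZ : IsComplexMultiplicativeSystem Z) (hm : ∀ n, Measurable (Z n))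
    (h1 : ∀ n t, ‖Z n t‖ ≤ 1) {δ : ℝ} (hδ : 0 < δ) :
    ∀ᵐ t ∂(volume : Measure unitInterval), ConvergesInPolydisc (randomCoeff a Z t) ∧
      ∃ E : Set (Fin p → ℝ), AsympFiniteLogMeasure E ∧ ∀ r ∈ cube p \ E,
        1 < maxTerm a r * ∏ j, 1 / (1 - r j) ∧
        maxModulus (randomCoeff a Z t) r ≤ maxTerm a r * ((∏ j, 1 / √(1 - r j)) *
          Real.log (maxTerm a r * ∏ j, 1 / (1 - r j)) ^ ((p : ℝ) / 4)) ^ (1 + δ) := by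
  obtain ⟨n₀, hn₀⟩ := Function.ne_iff.1 ha0
  -- A single nonzero coefficient bounds both the maximal term and the majorant below on the half
  -- corner.
  set c := weight a (fun _ => 1 / 2) n₀ with hcdef
  have hc : 0 < c := mul_pos (norm_pos_iff.2 hn₀) (Finset.prod_pos fun j _ => by positivity)
  have hcw : ∀ r ∈ halfCorner p, c ≤ weight a r n₀ := fun r hr =>
    mul_le_mul_of_nonneg_left (Finset.prod_le_prod (fun _ _ => by positivity) fun j _ =>
      pow_le_pow_left₀ (by norm_num) (mem_halfCorner.1 hr j).1 _) (norm_nonneg _)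
  have hμ : ∀ r ∈ halfCorner p, c ≤ maxTerm a r := fun r hr =>
    (hcw r hr).trans (weight_le_maxTerm ha hr.1 n₀)
  have hS : ∀ r ∈ halfCorner p, c ≤ majorant a r := fun r hr =>
    (hcw r hr).trans ((summable_weight ha hr.1).le_tsum n₀ fun n _ =>
      weight_nonneg a (fun j => (hr.1 j).1) n)
  have hp' : (1 : ℝ) ≤ p := by exact_mod_cast hp
  -- The constant 7 covers both smallness conditions of `exists_final_bound`.
  set ε := min 1 (δ / (7 * (p + 1))) with hεdef
  have hε : 0 < ε := lt_min one_pos (by positivity)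
  have hε1 : ε ≤ 1 := min_le_left _ _
  have hε2 : 7 * ((p + 1) * ε) ≤ δ := by
    have := min_le_right 1 (δ / (7 * ((p : ℝ) + 1)))
    rw [← hεdef, le_div_iff₀ (by positivity)] at this
    linarith
  obtain ⟨R, hR⟩ := exists_final_bound hp hc hε (by linarith) (by nlinarith) hδ
  -- The 2 keeps the corner inside the half corner, R is the threshold of the final bound, and e/c
  -- forces ln(μP) ≥ 1.
  set R' := max 2 (max R (Real.exp 1 / c)) with hR'def
  have hR'2 : 2 ≤ R' := le_max_left _ _
  have hR'R : R ≤ R' := (le_max_left _ _).trans (le_max_right _ _)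
  have hR'c : Real.exp 1 / c ≤ R' := (le_max_right _ _).trans (le_max_right _ _)
  have hinv : 1 / R' ≤ 1 / 2 := one_div_le_one_div_of_le two_pos hR'2
  have hinv0 : 0 < 1 / R' := by positivity
  set r₀ : Fin p → ℝ := fun _ => 1 - 1 / R' with hr₀
  have hhalf : corner r₀ ⊆ halfCorner p := fun r hr =>
    ⟨hr.1, fun j => le_trans (by simp only [hr₀]; linarith) (hr.2 j)⟩
  have hdens : ∀ r ∈ corner r₀, R' ≤ density r := by
    intro r hr
    refine le_trans ?_ (one_div_one_sub_le_density hr.1 ⟨0, hp⟩)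
    have h2 : 1 - 1 / R' ≤ r ⟨0, hp⟩ := hr.2 _
    rw [le_one_div (by linarith) (by linarith [(hr.1 ⟨0, hp⟩).2])]
    linarith
  obtain ⟨C, hC⟩ := exists_volume_badSet_le ha hZ hm h1 hc hε hS hμ
  filter_upwards [ae_logMeasure_section_lt_top (measurableSet_badSet a hm c ε)
    (fun x hx => hx.1.1) hC] with t ht
  refine ⟨convergesInPolydisc_of_norm_le ha (norm_randomCoeff_le fun n => h1 n t), ?_⟩
  set B := {r | (r, t) ∈ badSet a Z c ε}
  -- Everything outside the corner is put into E for free, since only the part of E inside the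
  -- corner has to have finite logarithmic measure.
  refine ⟨(cube p \ corner r₀) ∪ (irregularSet a c ε ∪ B), ⟨?_, ?_, r₀, ?_, ?_⟩, ?_⟩
  · exact union_subset sdiff_subset
      (union_subset (irregularSet_subset_cube a c ε) fun r hr => hr.1.1.1)
  · exact (measurableSet_cube.diff (measurableSet_corner _)).union
      ((measurableSet_irregularSet a c ε).union
        (measurable_prodMk_right (measurableSet_badSet a hm c ε)))
  · exact fun j => ⟨by simp only [hr₀]; linarith, by simp only [hr₀]; linarith⟩
  · refine (logMeasure_mono (F := irregularSet a c ε ∪ B) ?_).trans_lt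
      ((logMeasure_union_le _ _).trans_lt (ENNReal.add_lt_top.2
        ⟨logMeasure_irregularSet_lt_top ha hc hε hε1 hS, ht⟩))
    rintro r ⟨hr | hr, hrc⟩
    · exact absurd hrc hr.2
    · exact hr
  · rintro r ⟨hrc, hrE⟩
    simp only [mem_union, Set.mem_sdiff, not_or, not_and, not_not] at hrE
    obtain ⟨hr0, hirr, hbad⟩ := hrE
    have hr0 := hr0 hrc
    have hr := hhalf hr0
    have hPR := hdens r hr0
    have hlog : 1 ≤ Real.log (maxTerm a r * density r) := by
      rw [Real.le_log_iff_exp_le (mul_pos (hc.trans_le (hμ r hr)) (by linarith))]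
      have h2 := mul_le_mul (hμ r hr) (hR'c.trans hPR) (by positivity)
        (hc.le.trans (hμ r hr))
      rwa [mul_div_cancel₀ _ hc.ne'] at h2
    rw [prod_one_div_sqrt r hrc]
    change 1 < maxTerm a r * density r ∧ _
    refine ⟨?_, ?_⟩
    · by_contra! h
      have := Real.log_nonpos (mul_nonneg (hc.le.trans (hμ r hr)) (by linarith)) h
      linarith
    · exact (maxModulus_le_of_notMem_badSet hp ha (fun n => h1 n t) hc hε hε1 hr (hS r hr)
        (hμ r hr) hirr hbad).trans (hR _ _ _ (hμ r hr) (by linarith) (hR'R.trans hPR) (hS r hr) hlog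
          (majorant_le_of_notMem ha hc hε hε1 hr (hS r hr) hirr hp))

/-! ### Reduction to everywhere bounded measurable systems. -/

theorem IsMultiplicativeSystem.congr {ι : Type*} [Countable ι] {X Y : ι → unitInterval → ℝ}
    (hX : IsMultiplicativeSystem X) (h : ∀ n, X n =ᵐ[volume] Y n) : IsMultiplicativeSystem Y := by
  have hs : ∀ s : Finset ι, (fun t => ∏ n ∈ s, X n t) =ᵐ[volume] fun t => ∏ n ∈ s, Y n t := by
    intro s
    filter_upwards [ae_all_iff.2 h] with t ht
    exact Finset.prod_congr rfl fun n _ => ht n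
  exact ⟨fun n => (hX.aemeasurable n).congr (h n), fun s hn => (hX.integrable_prod s hn).congr (hs s),
    fun s hn => by rw [← integral_congr_ae (hs s), hX.integral_prod s hn]⟩

/-- A bounded complex multiplicative system has a measurable modification that is bounded
everywhere. -/
theorem exists_measurable_modification {ι : Type*} [Countable ι] {Z : ι → unitInterval → ℂ}
    (hZ : IsComplexMultiplicativeSystem Z)
    (hZ1 : ∀ n, ∀ᵐ t ∂(volume : Measure unitInterval), ‖Z n t‖ ≤ 1) :
    ∃ W : ι → unitInterval → ℂ, IsComplexMultiplicativeSystem W ∧ (∀ n, Measurable (W n)) ∧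
      (∀ n t, ‖W n t‖ ≤ 1) ∧ ∀ n, Z n =ᵐ[volume] W n := by
  have hZm : ∀ n, AEMeasurable (Z n) volume := fun n => by
    have h := ((Complex.measurable_ofReal.comp_aemeasurable (hZ.1.aemeasurable n))).add
      ((Complex.measurable_ofReal.comp_aemeasurable (hZ.2.aemeasurable n)).mul_const Complex.I)
    refine h.congr (ae_of_all _ fun t => ?_)
    simp [Complex.re_add_im]
  -- The measurable representative is set to zero where its norm exceeds 1, which changes it only on
  -- a null set.
  set A : ι → Set unitInterval := fun n => {t | ‖(hZm n).mk _ t‖ ≤ 1}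
  have hA : ∀ n, MeasurableSet (A n) := fun n =>
    measurableSet_le (hZm n).measurable_mk.norm measurable_const
  have hae : ∀ n, Z n =ᵐ[volume] (A n).indicator ((hZm n).mk _) := fun n => by
    filter_upwards [(hZm n).ae_eq_mk, hZ1 n] with t ht ht1
    have htA : t ∈ A n := show ‖(hZm n).mk _ t‖ ≤ 1 by rwa [← ht]
    rw [indicator_of_mem htA, ht]
  refine ⟨fun n => (A n).indicator ((hZm n).mk _), ⟨?_, ?_⟩,
    fun n => (hZm n).measurable_mk.indicator (hA n), fun n t => ?_, hae⟩
  · exact hZ.1.congr fun n => (hae n).fun_comp Complex.re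
  · exact hZ.2.congr fun n => (hae n).fun_comp Complex.im
  · beta_reduce
    by_cases ht : t ∈ A n
    · rw [indicator_of_mem ht]; exact ht
    · rw [indicator_of_notMem ht, norm_zero]; exact zero_le_one

end Polydisc

end

theorem theorem2p3 (p : ℕ) (hp : 1 ≤ p)
    (a : (Fin p → ℕ) → ℂ) (ha : Polydisc.ConvergesInPolydisc a) (ha0 : a ≠ 0)
    (Z : (Fin p → ℕ) → unitInterval → ℂ)
    (hZ : Polydisc.IsComplexMultiplicativeSystem Z)
    (hZ1 : ∀ n, ∀ᵐ t ∂(volume : Measure unitInterval), ‖Z n t‖ ≤ 1)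
    (δ : ℝ) (hδ : 0 < δ) :
    ∀ᵐ t ∂(volume : Measure unitInterval),
      Polydisc.ConvergesInPolydisc (Polydisc.randomCoeff a Z t) ∧
      ∃ E : Set (Fin p → ℝ), Polydisc.AsympFiniteLogMeasure E ∧
        ∀ r ∈ Polydisc.cube p \ E,
          1 < Polydisc.maxTerm a r * ∏ j, 1 / (1 - r j) ∧
          Polydisc.maxModulus (Polydisc.randomCoeff a Z t) r ≤
            Polydisc.maxTerm a r *
              ((∏ j, 1 / √(1 - r j)) *
                Real.log (Polydisc.maxTerm a r * ∏ j, 1 / (1 - r j)) ^ ((p : ℝ) / 4)) ^ (1 + δ) := by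
  obtain ⟨W, hW, hWm, hW1, hZW⟩ := Polydisc.exists_measurable_modification hZ hZ1
  filter_upwards [Polydisc.ae_maxModulus_le_of_measurable hp ha ha0 hW hWm hW1 hδ,
    ae_all_iff.2 hZW] with t ht hEq
  have hcoeff : Polydisc.randomCoeff a Z t = Polydisc.randomCoeff a W t :=
    funext fun n => by rw [Polydisc.randomCoeff, Polydisc.randomCoeff, hEq n]
  rwa [hcoeff]
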